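/- Let $\omega$ be a non-principal ultrafilter on the natural numbers. For a permutation $g$ in the symmetric group $S_n$ ($n\ge 1$) let $rk(g)=1-\frac{\mathrm{fix}(g)}{n}$, where $\mathrm{fix}(g)$ is the number of points of $\{1,\dots,n\}$ fixed by $g$. Let $H=\{(g_n)_{n\ge1}\in\prod_{n=1}^\infty S_n : \lim_\omega rk(g_n)=0\}$, a normal subgroup, let $\Sigma=\prod_{n=1}^\infty S_n/H$ be the universal sofic group, and put $rk(\underline g)=\lim_\omega rk(g_n)$ for the class $\underline g\in\Sigma$ of $(g_n)_{n\ge1}$. A faithful embedding of a group $\Gamma$ into $\Sigma$ is an injective homomorphism $\phi:\Gamma\to\Sigma$ such that $rk(\phi(\gamma))=1$ for all $1\ne\gamma\in\Gamma$. Two embeddings $\phi,\psi:\Gamma\to\Sigma$ are conjugate if there is $g\in\Sigma$ with $\phi(\gamma)=g\,\psi(\gamma)\,g^{-1}$ for all $\gamma\in\Gamma$. Theorem. Let $\Gamma$ be a finitely generated sofic group, that is, a finitely generated group that admits at least one faithful embedding into $\Sigma$. Then $\Gamma$ is amenable if and only if any two faithful embeddings of $\Gamma$ into $\Sigma$ are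 conjugate. -/

import Mathlib

open Filter Topology
open scoped Pointwise symmDiff

namespace SoficRep

/-- The normalized rank `1 - fix(g) / n` of a permutation `g` of a finite set with `n` elements. -/
noncomputable def permRank {α : Type*} [Fintype α] [DecidableEq α] (g : Equiv.Perm α) : ℝ :=
  1 - ((Finset.univ.filter fun x => g x = x).card : ℝ) / (Fintype.card α : ℝ)

/-- The product `∏_{n ≥ 1} S_n` of the finite symmetric groups. The factor with index `n : ℕ` is
the symmetric group on `n + 1` letters, so that the indices `0, 1, 2, …` give `S_1, S_2, S_3, …`. -/
abbrev SymProd : Type := ∀ n : ℕ, Equiv.Perm (Fin (n + 1))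

theorem permRank_eq_support {α : Type*} [Fintype α] [DecidableEq α] [Nonempty α]
    (g : Equiv.Perm α) : permRank g = (g.support.card : ℝ) / (Fintype.card α : ℝ) := by
  have h : (Finset.univ.filter fun x => g x = x).card + g.support.card = Fintype.card α := by
    have := Finset.card_filter_add_card_filter_not (s := (Finset.univ : Finset α))
      (fun x => g x = x)
    simpa [Equiv.Perm.support] using this
  have h' : ((Finset.univ.filter fun x => g x = x).card : ℝ) + g.support.card
      = Fintype.card α := by exact_mod_cast h
  have hc : (Fintype.card α : ℝ) ≠ 0 := by exact_mod_cast Fintype.card_ne_zero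
  unfold permRank
  field_simp
  linarith

theorem permRank_nonneg {α : Type*} [Fintype α] [DecidableEq α] [Nonempty α]
    (g : Equiv.Perm α) : 0 ≤ permRank g := by
  rw [permRank_eq_support]; positivity

theorem permRank_le_one {α : Type*} [Fintype α] [DecidableEq α]
    (g : Equiv.Perm α) : permRank g ≤ 1 := by
  unfold permRank
  have : 0 ≤ ((Finset.univ.filter fun x => g x = x).card : ℝ) / (Fintype.card α : ℝ) := by
    positivity
  linarith

theorem permRank_one {α : Type*} [Fintype α] [DecidableEq α] [Nonempty α] :
    permRank (1 : Equiv.Perm α) = 0 := by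
  simp [permRank_eq_support]

theorem permRank_inv {α : Type*} [Fintype α] [DecidableEq α] [Nonempty α]
    (g : Equiv.Perm α) : permRank g⁻¹ = permRank g := by
  simp [permRank_eq_support]

theorem permRank_conj {α : Type*} [Fintype α] [DecidableEq α] [Nonempty α]
    (g h : Equiv.Perm α) : permRank (h * g * h⁻¹) = permRank g := by
  simp [permRank_eq_support]

theorem permRank_mul_le {α : Type*} [Fintype α] [DecidableEq α] [Nonempty α]
    (g h : Equiv.Perm α) : permRank (g * h) ≤ permRank g + permRank h := by
  rw [permRank_eq_support, permRank_eq_support, permRank_eq_support, ← add_div]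
  have h1 : (g * h).support.card ≤ g.support.card + h.support.card :=
    (Finset.card_le_card (Equiv.Perm.support_mul_le g h)).trans (Finset.card_union_le _ _)
  have h2 : ((g * h).support.card : ℝ) ≤ g.support.card + h.support.card := by exact_mod_cast h1
  gcongr

/-- The ultralimit `lim_ω rk(g_n)` of the ranks of the entries of a sequence of permutations. -/
noncomputable def seqRank (ω : Ultrafilter ℕ) (g : SymProd) : ℝ :=
  limUnder (ω : Filter ℕ) fun n => permRank (g n)

/-- The ultralimit of the ranks always exists, because the ranks lie in `[0, 1]`. -/
theorem tendsto_seqRank (ω : Ultrafilter ℕ) (g : SymProd) :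
    Tendsto (fun n => permRank (g n)) (ω : Filter ℕ) (𝓝 (seqRank ω g)) := by
  have hK : IsCompact (Set.Icc (0 : ℝ) 1) := isCompact_Icc
  have hm : ((ω.map fun n => permRank (g n)) : Filter ℝ) ≤ 𝓟 (Set.Icc (0 : ℝ) 1) := by
    rw [le_principal_iff, Ultrafilter.mem_coe, Ultrafilter.mem_map]
    exact Filter.mem_of_superset Filter.univ_mem
      (fun n _ => ⟨permRank_nonneg (g n), permRank_le_one (g n)⟩)
  obtain ⟨a, -, ha⟩ := hK.ultrafilter_le_nhds _ hm
  exact tendsto_nhds_limUnder ⟨a, ha⟩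

/-- The normal subgroup `H = {(g_n) | lim_ω rk(g_n) = 0}` of `∏ S_n`. -/
def nullSubgroup (ω : Ultrafilter ℕ) : Subgroup SymProd where
  carrier := {g | Tendsto (fun n => permRank (g n)) (ω : Filter ℕ) (𝓝 0)}
  one_mem' := by
    simp only [Set.mem_ofPred_eq, Pi.one_apply, permRank_one]
    exact tendsto_const_nhds
  mul_mem' := by
    intro a b ha hb
    have hab := Tendsto.add ha hb
    rw [add_zero] at hab
    exact squeeze_zero (fun n => permRank_nonneg _) (fun n => permRank_mul_le (a n) (b n)) hab
  inv_mem' := by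
    intro a ha
    simpa only [Set.mem_ofPred_eq, Pi.inv_apply, permRank_inv] using ha

instance nullSubgroup_normal (ω : Ultrafilter ℕ) : (nullSubgroup ω).Normal where
  conj_mem := by
    intro a ha b
    change Tendsto (fun n => permRank (b n * a n * (b n)⁻¹)) (ω : Filter ℕ) (𝓝 0)
    simp only [permRank_conj]
    exact ha

/-- The universal sofic group `Σ = (∏_{n ≥ 1} S_n) / H`. -/
abbrev SoficGroup (ω : Ultrafilter ℕ) : Type := SymProd ⧸ nullSubgroup ω

theorem seqRank_le_of_rel (ω : Ultrafilter ℕ) {a b : SymProd} (h : a⁻¹ * b ∈ nullSubgroup ω) :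
    seqRank ω b ≤ seqRank ω a := by
  have hs := (tendsto_seqRank ω a).add
    (show Tendsto (fun n => permRank ((a⁻¹ * b) n)) (ω : Filter ℕ) (𝓝 0) from h)
  rw [add_zero] at hs
  refine le_of_tendsto_of_tendsto' (tendsto_seqRank ω b) hs fun n => ?_
  have := permRank_mul_le (a n) ((a⁻¹ * b) n)
  simpa using this

/-- The rank function on `Σ`: the rank of the class of `(g_n)` is `lim_ω rk(g_n)`. -/
noncomputable def rank (ω : Ultrafilter ℕ) : SoficGroup ω → ℝ :=
  Quotient.lift (seqRank ω) (by
    intro a b hab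
    have h : a⁻¹ * b ∈ nullSubgroup ω := QuotientGroup.leftRel_apply.mp hab
    have h' : b⁻¹ * a ∈ nullSubgroup ω := by
      simpa using (nullSubgroup ω).inv_mem h
    exact le_antisymm (seqRank_le_of_rel ω h') (seqRank_le_of_rel ω h))

/-- A faithful embedding of `Γ` into `Σ`: an injective homomorphism under which every `γ ≠ 1`
has rank `1`. -/
def IsFaithfulEmbedding {Γ : Type*} [Group Γ] (ω : Ultrafilter ℕ) (φ : Γ →* SoficGroup ω) : Prop :=
  Function.Injective φ ∧ ∀ γ : Γ, γ ≠ 1 → rank ω (φ γ) = 1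

/-- Two homomorphisms into `G` are conjugate if they differ by an inner automorphism of `G`. -/
def AreConjugate {Γ G : Type*} [Group Γ] [Group G] (φ ψ : Γ →* G) : Prop :=
  ∃ g : G, ∀ γ : Γ, φ γ = g * ψ γ * g⁻¹

open scoped Classical in
/-- Amenability of a discrete group, by the Følner condition: for every finite `K ⊆ Γ` and
`ε > 0` there is a finite nonempty `F ⊆ Γ` with `|kF ∆ F| ≤ ε |F|` for all `k ∈ K`. -/
def IsAmenable (Γ : Type*) [Group Γ] : Prop :=
  ∀ (K : Finset Γ) (ε : ℝ), 0 < ε →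
    ∃ F : Finset Γ, F.Nonempty ∧ ∀ k ∈ K, (((k • F) ∆ F).card : ℝ) ≤ ε * (F.card : ℝ)

end SoficRep

/-! Equality in Σ is equality off sets of density zero (`mk_eq_mk_iff`), so a faithful embedding
amounts to a sequence of maps from Γ to finite symmetric groups that is asymptotically
multiplicative and free (`IsSoficSeq`). Near most points such a sequence is a copy of any prescribed
finite piece of Γ.

Suppose Γ is amenable. As in Ornstein–Weiss quasi-tilings, two sofic sequences are covered by copies
of the same Følner sets. Tiles are added in pairs, one on each side, and matching corresponding
points gives a partial bijection that almost intertwines the two actions. Once a shape no longer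
fits on one side, double counting (`card_add_le_of_saturated`) shows that the cover of that side has
grown by a fixed proportion. The total tile size is bounded, so boundedly many shapes nearly exhaust
a side (`exists_tileMatching`); completing the matching to a bijection gives approximate conjugacy
on generators (`exists_approx_conj`).

Conversely, a sofic sequence σ is compared with a blow-up of itself: disjoint copies of a much
smaller term of σ. This is again sofic, and it preserves small blocks. Conjugacy transports the
blocks to a partition almost preserved by σ, and since the block size may grow arbitrarily slowly,
class sizes can be bounded uniformly (`eventually_isHyperfinite`). With the bound fixed, some class
has small boundary and contains only points where σ looks like Γ. A minimal set of this kind is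
connected, hence a copy of a finite subset of Γ, which is then a Følner set
(`exists_boundary_le_of_good`). -/

namespace SoficRep

/-! ### Density-zero sets and sofic sequences -/

open scoped Classical in
/-- A sequence of subsets of the sets `{0, …, n}` whose densities tend to `0` along `ω`. -/
def IsNull (ω : Ultrafilter ℕ) (P : ∀ n : ℕ, Fin (n + 1) → Prop) : Prop :=
  Tendsto (fun n => ((Finset.univ.filter (P n)).card : ℝ) / ((n : ℝ) + 1)) (ω : Filter ℕ) (𝓝 0)

theorem IsNull.mono {ω : Ultrafilter ℕ} {P Q : ∀ n : ℕ, Fin (n + 1) → Prop} (hQ : IsNull ω Q)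
    (h : ∀ n x, P n x → Q n x) : IsNull ω P := by
  classical
  refine squeeze_zero (fun n => by positivity) (fun n => ?_) hQ
  gcongr
  exact h n _

theorem IsNull.or {ω : Ultrafilter ℕ} {P Q : ∀ n : ℕ, Fin (n + 1) → Prop} (hP : IsNull ω P)
    (hQ : IsNull ω Q) : IsNull ω fun n x => P n x ∨ Q n x := by
  classical
  have h := Tendsto.add hP hQ
  rw [add_zero] at h
  refine squeeze_zero (fun n => by positivity) (fun n => ?_) h
  rw [← add_div]
  gcongr
  exact_mod_cast (Finset.card_le_card (t := Finset.univ.filter (P n) ∪ Finset.univ.filter (Q n))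
    (fun x hx => by simpa using hx)).trans (Finset.card_union_le _ _)

theorem isNull_false (ω : Ultrafilter ℕ) : IsNull ω fun _ _ => False := by
  simp [IsNull]

theorem IsNull.exists_mem {ι : Type*} {ω : Ultrafilter ℕ} {P : ι → ∀ n : ℕ, Fin (n + 1) → Prop}
    (s : Finset ι) (h : ∀ i ∈ s, IsNull ω (P i)) : IsNull ω fun n x => ∃ i ∈ s, P i n x := by
  classical
  induction s using Finset.induction_on with
  | empty => exact (isNull_false ω).mono fun n x hx => by simp at hx
  | insert a s ha ih =>
    refine ((h a (by simp)).or (ih fun i hi => h i (by simp [hi]))).mono fun n x hx => ?_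
    simpa using hx

open scoped Classical in
theorem IsNull.eventually_le {ω : Ultrafilter ℕ} {P : ∀ n : ℕ, Fin (n + 1) → Prop}
    (h : IsNull ω P) {δ : ℝ} (hδ : 0 < δ) :
    ∀ᶠ n in (ω : Filter ℕ), ((Finset.univ.filter (P n)).card : ℝ) ≤ δ * ((n : ℝ) + 1) := by
  filter_upwards [h.eventually_lt_const hδ] with n hn
  rw [div_lt_iff₀ (by positivity)] at hn
  exact hn.le

open scoped Classical in
theorem permRank_eq_card_ne {α : Type*} [Fintype α] [DecidableEq α] [Nonempty α]
    (g h : Equiv.Perm α) : permRank (g⁻¹ * h) =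
      ((Finset.univ.filter fun x => g x ≠ h x).card : ℝ) / (Fintype.card α : ℝ) := by
  rw [permRank_eq_support]
  congr 3
  ext x
  rw [Equiv.Perm.mem_support, Equiv.Perm.mul_apply, Ne, Equiv.Perm.inv_eq_iff_eq]
  simp [eq_comm]

theorem isNull_ne_iff {ω : Ultrafilter ℕ} {g h : SymProd} :
    IsNull ω (fun n x => g n x ≠ h n x) ↔ g⁻¹ * h ∈ nullSubgroup ω := by
  change _ ↔ Tendsto (fun n => permRank ((g n)⁻¹ * h n)) (ω : Filter ℕ) (𝓝 0)
  simp only [permRank_eq_card_ne, IsNull, Fintype.card_fin, Nat.cast_add, Nat.cast_one]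

/-- Equality in `Σ` means equality outside a set of density zero. -/
theorem mk_eq_mk_iff {ω : Ultrafilter ℕ} {g h : SymProd} :
    (QuotientGroup.mk g : SoficGroup ω) = QuotientGroup.mk h ↔
      IsNull ω (fun n x => g n x ≠ h n x) := by
  rw [QuotientGroup.eq, isNull_ne_iff]

theorem rank_mk_eq_one_iff {ω : Ultrafilter ℕ} {g : SymProd} :
    rank ω (QuotientGroup.mk g) = 1 ↔ IsNull ω (fun n x => g n x = x) := by
  have h : (fun n => ((Finset.univ.filter fun x => g n x = x).card : ℝ) / ((n : ℝ) + 1)) =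
      fun n => 1 - permRank (g n) := by
    funext n
    simp [permRank]
  have hr : rank ω (QuotientGroup.mk g) = seqRank ω g := rfl
  have ht : Tendsto (fun n => 1 - permRank (g n)) (ω : Filter ℕ) (𝓝 (1 - seqRank ω g)) :=
    (tendsto_seqRank ω g).const_sub 1
  have hn : IsNull ω (fun n x => g n x = x) ↔
      Tendsto (fun n => 1 - permRank (g n)) (ω : Filter ℕ) (𝓝 0) := by
    rw [← h]
    unfold IsNull
    refine iff_of_eq ?_
    congr!
  rw [hr, hn]
  constructor
  · intro h1
    simpa [h1] using ht
  · intro h0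
    have := tendsto_nhds_unique ht h0
    linarith

/-- A sequence of maps `Γ → S_{n+1}` that is asymptotically multiplicative and free along `ω`. -/
structure IsSoficSeq {Γ : Type*} [Group Γ] (ω : Ultrafilter ℕ)
    (σ : ∀ n : ℕ, Γ → Equiv.Perm (Fin (n + 1))) : Prop where
  mul : ∀ g h : Γ, IsNull ω fun n x => σ n g (σ n h x) ≠ σ n (g * h) x
  free : ∀ g : Γ, g ≠ 1 → IsNull ω fun n x => σ n g x = x

theorem IsFaithfulEmbedding.exists_isSoficSeq {Γ : Type*} [Group Γ] {ω : Ultrafilter ℕ}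
    {φ : Γ →* SoficGroup ω} (hφ : IsFaithfulEmbedding ω φ) :
    ∃ σ : ∀ n : ℕ, Γ → Equiv.Perm (Fin (n + 1)), IsSoficSeq ω σ ∧
      ∀ g, φ g = QuotientGroup.mk fun n => σ n g := by
  choose s hs using fun g => QuotientGroup.mk_surjective (φ g)
  refine ⟨fun n g => s g n, ⟨fun g h => ?_, fun g hg => ?_⟩, fun g => (hs g).symm⟩
  · have : (QuotientGroup.mk (s g * s h) : SoficGroup ω) = QuotientGroup.mk (s (g * h)) := by
      rw [hs, map_mul, ← hs g, ← hs h, QuotientGroup.mk_mul]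
    exact (mk_eq_mk_iff.1 this).mono fun n x hx => hx
  · have := hφ.2 g hg
    rw [← hs] at this
    exact (rank_mk_eq_one_iff.1 this).mono fun n x hx => hx

theorem IsSoficSeq.exists_embedding {Γ : Type*} [Group Γ] {ω : Ultrafilter ℕ}
    {σ : ∀ n : ℕ, Γ → Equiv.Perm (Fin (n + 1))} (hσ : IsSoficSeq ω σ) :
    ∃ φ : Γ →* SoficGroup ω, IsFaithfulEmbedding ω φ ∧
      ∀ g, φ g = QuotientGroup.mk fun n => σ n g := by
  let φ : Γ →* SoficGroup ω := MonoidHom.mk' (fun g => QuotientGroup.mk fun n => σ n g)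
    (fun g h => by
      rw [← QuotientGroup.mk_mul]
      exact (mk_eq_mk_iff.2 ((hσ.mul g h).mono fun n x hx => hx)).symm)
  have h1 : ∀ γ : Γ, γ ≠ 1 → rank ω (φ γ) = 1 := fun γ hγ =>
    rank_mk_eq_one_iff.2 (hσ.free γ hγ)
  refine ⟨φ, ⟨(injective_iff_map_eq_one φ).2 fun γ hγ => ?_, h1⟩, fun g => rfl⟩
  -- A nontrivial kernel element would give the identity rank 1, so the set of all points would have
  -- density zero.
  by_contra hne
  have h2 := h1 γ hne
  rw [hγ] at h2
  have h3 := (rank_mk_eq_one_iff (g := (1 : SymProd))).1 h2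
  have h4 : (fun n : ℕ => (1 : ℝ)) = fun n : ℕ => (((Finset.univ.filter
      fun x : Fin (n + 1) => (1 : SymProd) n x = x).card : ℝ) / ((n : ℝ) + 1)) := by
    funext n
    simp
    field_simp
  have h5 : Tendsto (fun n : ℕ => (1 : ℝ)) (ω : Filter ℕ) (𝓝 0) := by
    rw [h4]
    unfold IsNull at h3
    convert h3
  exact one_ne_zero (tendsto_nhds_unique tendsto_const_nhds h5)

/-- At the point `x`, the map `σ` is multiplicative and free on the finite set `W`. -/
def GoodAt {Γ X : Type*} [Group Γ] (σ : Γ → Equiv.Perm X) (W : Finset Γ) (x : X) : Prop :=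
  (∀ g ∈ W, ∀ h ∈ W, σ g (σ h x) = σ (g * h) x) ∧ ∀ g ∈ W, ∀ h ∈ W, σ g x = σ h x → g = h

theorem GoodAt.map_one {Γ X : Type*} [Group Γ] {σ : Γ → Equiv.Perm X} {W : Finset Γ} {x : X}
    (h : GoodAt σ W x) (h1 : (1 : Γ) ∈ W) : σ 1 x = x := by
  have := h.1 1 h1 1 h1
  rw [mul_one] at this
  exact (σ 1).injective this

/-- Being good on a finite set is a finite conjunction of conditions, each failing only on a null
set. -/
theorem IsSoficSeq.isNull_not_goodAt {Γ : Type*} [Group Γ] {ω : Ultrafilter ℕ}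
    {σ : ∀ n : ℕ, Γ → Equiv.Perm (Fin (n + 1))} (hσ : IsSoficSeq ω σ) (W : Finset Γ) :
    IsNull ω fun n x => ¬ GoodAt (σ n) W x := by
  have h1 : IsNull ω fun n x => ∃ q ∈ W ×ˢ W, σ n q.1 (σ n q.2 x) ≠ σ n (q.1 * q.2) x :=
    IsNull.exists_mem _ fun q _ => hσ.mul q.1 q.2
  have h2 : IsNull ω fun n x => ∃ q ∈ W ×ˢ W, q.1 ≠ q.2 ∧ σ n q.1 x = σ n q.2 x := by
    refine IsNull.exists_mem _ fun q _ => ?_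
    by_cases hq : q.1 = q.2
    · exact (isNull_false ω).mono fun n x hx => hx.1 hq
    -- Where the product of `q.2` and `q.2⁻¹ * q.1` is respected, a coincidence of the images of `x`
    -- makes `q.2⁻¹ * q.1` fix `x`.
    · have hne : q.2⁻¹ * q.1 ≠ 1 := fun h => hq (inv_mul_eq_one.1 h).symm
      refine ((hσ.mul q.2 (q.2⁻¹ * q.1)).or (hσ.free _ hne)).mono fun n x hx => ?_
      by_contra hcon
      push Not at hcon
      apply hcon.2
      have := hcon.1
      rw [mul_inv_cancel_left, hx.2] at this
      exact (σ n q.2).injective this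
  refine (h1.or h2).mono fun n x hx => ?_
  by_contra hcon
  push Not at hcon
  exact hx ⟨fun g hg h hh => hcon.1 (g, h) (by simp [hg, hh]), fun g hg h hh hgh => by
    by_contra hne
    exact hcon.2 (g, h) (by simp [hg, hh]) hne hgh⟩

/-! ### Boundaries and matchings built from tiles -/

open scoped Classical in
/-- The set of points of `D` that `g` moves out of `D`. -/
noncomputable def exits {X : Type*} (g : X → X) (D : Finset X) : Finset X :=
  D.filter fun x => g x ∉ D

@[simp]
theorem mem_exits {X : Type*} {g : X → X} {D : Finset X} {x : X} :
    x ∈ exits g D ↔ x ∈ D ∧ g x ∉ D := by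
  simp [exits]

/-- The number of points of `D` that `g` moves out of `D`. -/
noncomputable def boundary {X : Type*} (g : X → X) (D : Finset X) : ℕ :=
  (exits g D).card

theorem boundary_empty {X : Type*} (g : X → X) : boundary g ∅ = 0 := by simp [boundary, exits]

open scoped Classical in
/-- A permutation moves as many points into a finite set as it moves out of it. -/
theorem card_inner_boundary {X : Type*} [Fintype X] (g : Equiv.Perm X) (D : Finset X) :
    (Finset.univ.filter fun x => x ∉ D ∧ g x ∈ D).card = boundary g D := by
  have h1 := Finset.card_filter_add_card_filter_not (s := D) (fun x => g x ∈ D)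
  have h2 := Finset.card_filter_add_card_filter_not
    (s := Finset.univ.filter fun x => g x ∈ D) (fun x => x ∈ D)
  have h3 : (Finset.univ.filter fun x => g x ∈ D).card = D.card := by
    rw [← Finset.card_map g.toEmbedding]
    congr 1
    ext y
    simp only [Finset.mem_map_equiv, Finset.mem_filter, Finset.mem_univ, true_and,
      Equiv.apply_symm_apply]
  have h4 : D.filter (fun x => g x ∈ D) =
      (Finset.univ.filter fun x => g x ∈ D).filter (fun x => x ∈ D) := by
    ext x; simp [and_comm]
  have h5 : (Finset.univ.filter fun x => x ∉ D ∧ g x ∈ D) =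
      (Finset.univ.filter fun x => g x ∈ D).filter (fun x => ¬ x ∈ D) := by
    ext x; simp [and_comm]
  rw [h5, boundary, exits]
  rw [← h4] at h2
  omega

/-- A partial bijection `M` between two finite sets with maps `Γ → Sym`, assembled from pairs of
tiles of total size `T` that cover `D` and `R`, almost disjoint and almost invariant under `S`. -/
structure TileMatching {Γ X Y : Type*} (σ : Γ → Equiv.Perm X)
    (τ : Γ → Equiv.Perm Y) (S : Finset Γ) (κ : ℝ) where
  D : Finset X
  R : Finset Y
  M : Finset (X × Y)
  T : ℕ
  fst_mem : ∀ q ∈ M, q.1 ∈ D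
  snd_mem : ∀ q ∈ M, q.2 ∈ R
  fst_inj : Set.InjOn Prod.fst (M : Set (X × Y))
  snd_inj : Set.InjOn Prod.snd (M : Set (X × Y))
  card_D : D.card ≤ T
  card_R : R.card ≤ T
  le_card_M : (1 - 2 * κ) * T ≤ M.card
  boundary_M : ∀ s ∈ S, (boundary (Prod.map (σ s) (τ s)) M : ℝ) ≤ 3 * κ * T

namespace TileMatching

variable {Γ X Y : Type*} {σ : Γ → Equiv.Perm X} {τ : Γ → Equiv.Perm Y} {S : Finset Γ} {κ : ℝ}

/-- The empty matching. -/
def empty (σ : Γ → Equiv.Perm X) (τ : Γ → Equiv.Perm Y) (S : Finset Γ) (κ : ℝ) :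
    TileMatching σ τ S κ where
  D := ∅
  R := ∅
  M := ∅
  T := 0
  fst_mem := by simp
  snd_mem := by simp
  fst_inj := by simp
  snd_inj := by simp
  card_D := by simp
  card_R := by simp
  le_card_M := by simp
  boundary_M := by simp [boundary_empty]

/-- `Q` arises from `P` by adding tiles whose boundaries have density at most `η` under `V`. -/
structure Extends (P Q : TileMatching σ τ S κ) (V : Finset Γ) (η : ℝ) : Prop where
  D_subset : P.D ⊆ Q.D
  R_subset : P.R ⊆ Q.R
  T_le : P.T ≤ Q.T
  card_D : Q.D.card + P.T ≤ P.D.card + Q.T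
  card_R : Q.R.card + P.T ≤ P.R.card + Q.T
  boundary_D : ∀ s ∈ V, (boundary (σ s) Q.D : ℝ) ≤ boundary (σ s) P.D + η * (Q.T - P.T)
  boundary_R : ∀ s ∈ V, (boundary (τ s) Q.R : ℝ) ≤ boundary (τ s) P.R + η * (Q.T - P.T)

theorem Extends.refl (P : TileMatching σ τ S κ) (V : Finset Γ) (η : ℝ) : P.Extends P V η :=
  ⟨subset_rfl, subset_rfl, le_rfl, le_rfl, le_rfl, by simp, by simp⟩

theorem Extends.trans {P Q N : TileMatching σ τ S κ} {V : Finset Γ} {η : ℝ}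
    (h : P.Extends Q V η) (h' : Q.Extends N V η) : P.Extends N V η where
  D_subset := h.D_subset.trans h'.D_subset
  R_subset := h.R_subset.trans h'.R_subset
  T_le := h.T_le.trans h'.T_le
  card_D := by have := h.card_D; have := h'.card_D; omega
  card_R := by have := h.card_R; have := h'.card_R; omega
  boundary_D s hs := by have := h.boundary_D s hs; have := h'.boundary_D s hs; linarith
  boundary_R s hs := by have := h.boundary_R s hs; have := h'.boundary_R s hs; linarith

open scoped Classical in
-- At a good centre, multiplicativity turns an exit from the new tile into an exit from its shape
-- `F` in the group.
theorem boundary_union_image_le [Group Γ] {D : Finset X} {F W : Finset Γ} {c : X} {s : Γ}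
    (hc : GoodAt σ W c) (hF : F ⊆ W) (hs : s ∈ W) :
    boundary (σ s) (D ∪ F.image fun f => σ f c) ≤
      boundary (σ s) D + boundary (fun f => s * f) F := by
  unfold boundary
  refine (Finset.card_le_card (t := exits (σ s) D ∪
    (exits (fun f => s * f) F).image fun f => σ f c) ?_).trans
    ((Finset.card_union_le _ _).trans (Nat.add_le_add_left Finset.card_image_le _))
  intro x hx
  simp only [mem_exits, Finset.mem_union, Finset.mem_image, not_or, not_exists,
    not_and] at hx ⊢
  obtain ⟨hx | ⟨f, hf, rfl⟩, h1, h2⟩ := hx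
  · exact Or.inl ⟨hx, h1⟩
  · refine Or.inr ⟨f, ⟨hf, fun hsf => h2 _ hsf ?_⟩, rfl⟩
    exact (hc.1 s hs f (hF hf)).symm

open scoped Classical in
/-- Adding a pair of tiles with centres `c` and `d`. -/
theorem exists_add_tile [Group Γ] (P : TileMatching σ τ S κ) {F V W : Finset Γ} {η : ℝ}
    (hSF : ∀ s ∈ S, (boundary (fun f => s * f) F : ℝ) ≤ κ * F.card)
    (hVF : ∀ s ∈ V, (boundary (fun f => s * f) F : ℝ) ≤ η * F.card)
    (hSW : S ⊆ W) (hVW : V ⊆ W) (hFW : F ⊆ W) {c : X} {d : Y}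
    (hc : GoodAt σ W c) (hd : GoodAt τ W d)
    (hcD : ((F.filter fun f => σ f c ∈ P.D).card : ℝ) ≤ κ * F.card)
    (hdR : ((F.filter fun f => τ f d ∈ P.R).card : ℝ) ≤ κ * F.card) :
    ∃ Q : TileMatching σ τ S κ, P.Extends Q V η ∧ Q.T = P.T + F.card := by
  -- Only positions that are fresh on both sides enter the matching, at a loss of at most `2 * κ *
  -- F.card`. The covers still receive the whole tiles, so that their boundaries grow only by the
  -- boundary of `F`.
  set F' := F.filter fun f => σ f c ∉ P.D ∧ τ f d ∉ P.R with hF'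
  have hF'F : F' ⊆ F := Finset.filter_subset _ _
  have hdiff : ((F \ F').card : ℝ) ≤ 2 * κ * F.card := by
    have h1 : (F \ F').card ≤
        (F.filter fun f => σ f c ∈ P.D).card + (F.filter fun f => τ f d ∈ P.R).card := by
      refine (Finset.card_le_card fun f hf => ?_).trans (Finset.card_union_le _ _)
      simp only [hF', Finset.mem_sdiff, Finset.mem_filter, Finset.mem_union, not_and] at hf ⊢
      by_contra hcon
      push Not at hcon
      exact hf.2 hf.1 (fun h => hcon.1 hf.1 h) (hcon.2 hf.1)
    have h2 : ((F \ F').card : ℝ) ≤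
        (F.filter fun f => σ f c ∈ P.D).card + (F.filter fun f => τ f d ∈ P.R).card := by
      exact_mod_cast h1
    linarith
  have hcardF' : (F'.card : ℝ) = F.card - (F \ F').card := by
    have := Finset.card_sdiff_add_card_eq_card hF'F
    have h : ((F \ F').card : ℝ) + F'.card = F.card := by exact_mod_cast this
    linarith
  have hinjc : Set.InjOn (fun f => σ f c) (F : Set Γ) := fun f hf g hg h =>
    hc.2 f (hFW hf) g (hFW hg) h
  have hinjd : Set.InjOn (fun f => τ f d) (F : Set Γ) := fun f hf g hg h =>
    hd.2 f (hFW hf) g (hFW hg) h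
  set N : Finset (X × Y) := F'.image fun f => (σ f c, τ f d) with hN
  have hNcard : N.card = F'.card := by
    refine Finset.card_image_of_injOn fun f hf g hg h => ?_
    exact hinjc (hF'F hf) (hF'F hg) (congrArg Prod.fst h)
  have hdisj : Disjoint P.M N := by
    rw [Finset.disjoint_left]
    intro q hq hqN
    obtain ⟨f, hf, rfl⟩ := Finset.mem_image.1 hqN
    exact (Finset.mem_filter.1 hf).2.1 (P.fst_mem _ hq)
  refine ⟨{ D := P.D ∪ F.image fun f => σ f c
            R := P.R ∪ F.image fun f => τ f d
            M := P.M ∪ N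
            T := P.T + F.card
            fst_mem := ?_, snd_mem := ?_, fst_inj := ?_, snd_inj := ?_, card_D := ?_, card_R := ?_,
            le_card_M := ?_, boundary_M := ?_ }, ?_, rfl⟩
  · intro q hq
    rcases Finset.mem_union.1 hq with hq | hq
    · exact Finset.mem_union_left _ (P.fst_mem q hq)
    · obtain ⟨f, hf, rfl⟩ := Finset.mem_image.1 hq
      exact Finset.mem_union_right _ (Finset.mem_image_of_mem _ (hF'F hf))
  · intro q hq
    rcases Finset.mem_union.1 hq with hq | hq
    · exact Finset.mem_union_left _ (P.snd_mem q hq)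
    · obtain ⟨f, hf, rfl⟩ := Finset.mem_image.1 hq
      exact Finset.mem_union_right _ (Finset.mem_image_of_mem _ (hF'F hf))
  · intro q hq r hr hqr
    rcases Finset.mem_union.1 hq with hq | hq <;> rcases Finset.mem_union.1 hr with hr | hr
    · exact P.fst_inj hq hr hqr
    · obtain ⟨f, hf, rfl⟩ := Finset.mem_image.1 hr
      exact absurd ((show q.1 = σ f c from hqr) ▸ P.fst_mem q hq) (Finset.mem_filter.1 hf).2.1
    · obtain ⟨f, hf, rfl⟩ := Finset.mem_image.1 hq
      exact absurd ((show r.1 = σ f c from hqr.symm) ▸ P.fst_mem r hr) (Finset.mem_filter.1 hf).2.1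
    · obtain ⟨f, hf, rfl⟩ := Finset.mem_image.1 hq
      obtain ⟨g, hg, rfl⟩ := Finset.mem_image.1 hr
      rw [hinjc (hF'F hf) (hF'F hg) hqr]
  · intro q hq r hr hqr
    rcases Finset.mem_union.1 hq with hq | hq <;> rcases Finset.mem_union.1 hr with hr | hr
    · exact P.snd_inj hq hr hqr
    · obtain ⟨f, hf, rfl⟩ := Finset.mem_image.1 hr
      exact absurd ((show q.2 = τ f d from hqr) ▸ P.snd_mem q hq) (Finset.mem_filter.1 hf).2.2
    · obtain ⟨f, hf, rfl⟩ := Finset.mem_image.1 hq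
      exact absurd ((show r.2 = τ f d from hqr.symm) ▸ P.snd_mem r hr) (Finset.mem_filter.1 hf).2.2
    · obtain ⟨f, hf, rfl⟩ := Finset.mem_image.1 hq
      obtain ⟨g, hg, rfl⟩ := Finset.mem_image.1 hr
      rw [hinjd (hF'F hf) (hF'F hg) hqr]
  · exact (Finset.card_union_le _ _).trans (Nat.add_le_add P.card_D Finset.card_image_le)
  · exact (Finset.card_union_le _ _).trans (Nat.add_le_add P.card_R Finset.card_image_le)
  · rw [Finset.card_union_of_disjoint hdisj, hNcard]
    push_cast
    rw [hcardF']
    linarith [P.le_card_M]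
  · intro s hs
    -- A new pair exits either because `s * f` leaves `F`, or because `s * f` lands in the discarded
    -- part `F \ F'`. These contribute `κ` and `2 * κ`, whence the factor 3 in `boundary_M`.
    have h1 : boundary (Prod.map (σ s) (τ s)) (P.M ∪ N) ≤
        boundary (Prod.map (σ s) (τ s)) P.M + (boundary (fun f => s * f) F + (F \ F').card) := by
      unfold boundary
      refine (Finset.card_le_card (t := exits (Prod.map (σ s) (τ s)) P.M ∪
        ((exits (fun f => s * f) F).image (fun f => (σ f c, τ f d)) ∪
          (F'.filter fun f => s * f ∈ F \ F').image (fun f => (σ f c, τ f d)))) ?_).trans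
        ((Finset.card_union_le _ _).trans ?_)
      · intro q hq
        obtain ⟨hq, hsq⟩ := mem_exits.1 hq
        rw [Finset.mem_union, not_or] at hsq
        rcases Finset.mem_union.1 hq with hq | hq
        · exact Finset.mem_union_left _ (mem_exits.2 ⟨hq, hsq.1⟩)
        · obtain ⟨f, hf, rfl⟩ := Finset.mem_image.1 hq
          refine Finset.mem_union_right _ ?_
          have hsf : s * f ∉ F' := fun hsf => hsq.2 (by
            refine Finset.mem_image.2 ⟨s * f, hsf, ?_⟩
            rw [Prod.map_apply, hc.1 s (hSW hs) f (hFW (hF'F hf)),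
              hd.1 s (hSW hs) f (hFW (hF'F hf))])
          by_cases hsF : s * f ∈ F
          · exact Finset.mem_union_right _ (Finset.mem_image_of_mem _
              (Finset.mem_filter.2 ⟨hf, Finset.mem_sdiff.2 ⟨hsF, hsf⟩⟩))
          · exact Finset.mem_union_left _ (Finset.mem_image_of_mem _
              (mem_exits.2 ⟨hF'F hf, hsF⟩))
      · refine Nat.add_le_add_left ((Finset.card_union_le _ _).trans
          (Nat.add_le_add Finset.card_image_le (Finset.card_image_le.trans ?_))) _
        exact Finset.card_le_card_of_injOn (fun f => s * f)
          (fun f hf => (Finset.mem_filter.1 hf).2) fun f _ g _ h => mul_left_cancel h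
    have h2 : (boundary (Prod.map (σ s) (τ s)) (P.M ∪ N) : ℝ) ≤
        boundary (Prod.map (σ s) (τ s)) P.M + (boundary (fun f => s * f) F + (F \ F').card) := by
      exact_mod_cast h1
    have h3 := P.boundary_M s hs
    have h4 := hSF s hs
    push_cast
    linarith
  · refine ⟨Finset.subset_union_left, Finset.subset_union_left, Nat.le_add_right _ _, ?_, ?_,
      fun s hs => ?_, fun s hs => ?_⟩
    · have h := (Finset.card_union_le P.D (F.image fun f => σ f c)).trans
        (Nat.add_le_add_left Finset.card_image_le _)
      dsimp only
      omega
    · have h := (Finset.card_union_le P.R (F.image fun f => τ f d)).trans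
        (Nat.add_le_add_left Finset.card_image_le _)
      dsimp only
      omega
    · have h : (boundary (σ s) (P.D ∪ F.image fun f => σ f c) : ℝ) ≤
          boundary (σ s) P.D + boundary (fun f => s * f) F := by
        exact_mod_cast boundary_union_image_le hc hFW (hVW hs)
      have := hVF s hs
      push_cast
      linarith
    · have h : (boundary (τ s) (P.R ∪ F.image fun f => τ f d) : ℝ) ≤
          boundary (τ s) P.R + boundary (fun f => s * f) F := by
        exact_mod_cast boundary_union_image_le hd hFW (hVW hs)
      have := hVF s hs
      push_cast
      linarith

/-- The matching has at most `Fintype.card X` pairs and at least half of the total tile size. This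
bound makes the greedy construction stop. -/
theorem T_le_two_mul [Fintype X] (P : TileMatching σ τ S κ) (hκ : κ ≤ 1 / 4) :
    (P.T : ℝ) ≤ 2 * Fintype.card X := by
  have h1 : P.M.card ≤ Fintype.card X :=
    (Finset.card_le_card_of_injOn (t := Finset.univ) Prod.fst (by simp) P.fst_inj)
  have h2 : (P.M.card : ℝ) ≤ Fintype.card X := by exact_mod_cast h1
  have h3 := P.le_card_M
  have h4 : (0 : ℝ) ≤ P.T := Nat.cast_nonneg _
  nlinarith

end TileMatching

open scoped Classical in
/-- If every good tile overlaps `D` in a proportion `κ`, then `D` is substantially larger than any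
almost invariant subset `D₀` of density at most `1 - κ`. -/
theorem card_add_le_of_saturated {Γ X : Type*} [Group Γ] [Fintype X] {σ : Γ → Equiv.Perm X}
    {F W : Finset Γ} (hF : F.Nonempty) {κ : ℝ} (hκ : 0 < κ) {D₀ D : Finset X} (hD : D₀ ⊆ D)
    (hbad : ((Finset.univ.filter fun x => ¬ GoodAt σ W x).card : ℝ) ≤ κ / 4 * Fintype.card X)
    (hsat : ∀ c, GoodAt σ W c → κ * F.card < (F.filter fun f => σ f c ∈ D).card)
    (hinv : ∀ f ∈ F, (boundary (σ f) D₀ : ℝ) ≤ κ ^ 2 / 4 * Fintype.card X)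
    (hcard : (D₀.card : ℝ) ≤ (1 - κ) * Fintype.card X) :
    (D₀.card : ℝ) + κ ^ 2 / 2 * Fintype.card X ≤ D.card := by
  -- The pairs `(c, f)` with `c ∈ G`, `f ∈ F` and `σ f c ∈ D` are counted in two ways. Saturation
  -- gives the lower bound, and `G` has density at least `3 / 4 * κ`.
  set G := Finset.univ.filter fun x => x ∉ D₀ ∧ GoodAt σ W x with hG
  have hFpos : (0 : ℝ) < F.card := by exact_mod_cast hF.card_pos
  have hdd : ((D \ D₀).card : ℝ) + D₀.card = D.card := by
    exact_mod_cast Finset.card_sdiff_add_card_eq_card hD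
  have hGcard : (Fintype.card X : ℝ) ≤
      G.card + D₀.card + (Finset.univ.filter fun x => ¬ GoodAt σ W x).card := by
    have : Fintype.card X ≤
        G.card + D₀.card + (Finset.univ.filter fun x => ¬ GoodAt σ W x).card := by
      rw [← Finset.card_univ]
      refine (Finset.card_le_card (t := (G ∪ D₀) ∪
        Finset.univ.filter fun x => ¬ GoodAt σ W x) fun x _ => ?_).trans
        ((Finset.card_union_le _ _).trans (Nat.add_le_add_right (Finset.card_union_le _ _) _))
      simp only [hG, Finset.mem_union, Finset.mem_filter, Finset.mem_univ, true_and]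
      tauto
    exact_mod_cast this
  have hlow : (G.card : ℝ) * (κ * F.card) ≤
      ∑ c ∈ G, ((F.filter fun f => σ f c ∈ D).card : ℝ) := by
    rw [← nsmul_eq_mul]
    exact Finset.card_nsmul_le_sum _ _ _ fun c hc => (hsat c (Finset.mem_filter.1 hc).2.2).le
  have hswap : ∑ c ∈ G, ((F.filter fun f => σ f c ∈ D).card : ℝ) =
      ∑ f ∈ F, ((G.filter fun c => σ f c ∈ D).card : ℝ) := by
    have := Finset.sum_card_bipartiteAbove_eq_sum_card_bipartiteBelow (s := G) (t := F)
      (fun c f => σ f c ∈ D)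
    exact_mod_cast this
  have hup : ∑ f ∈ F, ((G.filter fun c => σ f c ∈ D).card : ℝ) ≤
      F.card * (κ ^ 2 / 4 * Fintype.card X + (D \ D₀).card) := by
    rw [← nsmul_eq_mul]
    refine Finset.sum_le_card_nsmul _ _ _ fun f hf => ?_
    -- A point outside `D₀` that is sent into `D` either crosses into `D₀`, which happens as often
    -- as crossing out, or lands in the new part.
    have h1 : (G.filter fun c => σ f c ∈ D).card ≤ boundary (σ f) D₀ + (D \ D₀).card := by
      rw [← card_inner_boundary, ← Finset.card_map (σ f).symm.toEmbedding (s := D \ D₀)]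
      refine (Finset.card_le_card fun c hc => ?_).trans (Finset.card_union_le _ _)
      simp only [hG, Finset.mem_filter, Finset.mem_univ, true_and, Finset.mem_union,
        Finset.mem_map_equiv, Equiv.symm_symm, Finset.mem_sdiff] at hc ⊢
      tauto
    have h2 : ((G.filter fun c => σ f c ∈ D).card : ℝ) ≤
        boundary (σ f) D₀ + (D \ D₀).card := by exact_mod_cast h1
    linarith [hinv f hf]
  have h1 : (F.card : ℝ) * (G.card * κ) ≤
      F.card * (κ ^ 2 / 4 * Fintype.card X + (D \ D₀).card) := by
    calc _ = (G.card : ℝ) * (κ * F.card) := by ring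
      _ ≤ _ := by rw [hswap] at hlow; exact hlow.trans hup
  have h2 := le_of_mul_le_mul_left h1 hFpos
  have h3 : (3 / 4 * κ * Fintype.card X : ℝ) ≤ G.card := by linarith
  have h4 : (3 / 4 * κ * Fintype.card X : ℝ) * κ ≤ G.card * κ := by gcongr
  nlinarith

namespace TileMatching

variable {Γ X Y : Type*} {σ : Γ → Equiv.Perm X} {τ : Γ → Equiv.Perm Y} {S : Finset Γ} {κ : ℝ}

open scoped Classical in
/-- Adding tiles of shape `F` as long as possible enlarges the total size by a definite amount. -/
theorem exists_extends [Group Γ] [Fintype X] [Fintype Y] (hXY : Fintype.card X = Fintype.card Y)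
    (hκ : 0 < κ) (hκ4 : κ ≤ 1 / 4) (P : TileMatching σ τ S κ) {F V W : Finset Γ} {η : ℝ}
    (hF : F.Nonempty)
    (hSF : ∀ s ∈ S, (boundary (fun f => s * f) F : ℝ) ≤ κ * F.card)
    (hVF : ∀ s ∈ V, (boundary (fun f => s * f) F : ℝ) ≤ η * F.card)
    (hSW : S ⊆ W) (hVW : V ⊆ W) (hFW : F ⊆ W)
    (hσ : ((Finset.univ.filter fun x => ¬ GoodAt σ W x).card : ℝ) ≤ κ / 4 * Fintype.card X)
    (hτ : ((Finset.univ.filter fun x => ¬ GoodAt τ W x).card : ℝ) ≤ κ / 4 * Fintype.card X)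
    (hD : ∀ f ∈ F, (boundary (σ f) P.D : ℝ) ≤ κ ^ 2 / 4 * Fintype.card X)
    (hR : ∀ f ∈ F, (boundary (τ f) P.R : ℝ) ≤ κ ^ 2 / 4 * Fintype.card X)
    (hDc : (P.D.card : ℝ) ≤ (1 - κ) * Fintype.card X)
    (hRc : (P.R.card : ℝ) ≤ (1 - κ) * Fintype.card X) :
    ∃ Q : TileMatching σ τ S κ, P.Extends Q V η ∧
      (P.T : ℝ) + κ ^ 2 / 2 * Fintype.card X ≤ Q.T := by
  set A : Set ℕ := {t | ∃ Q : TileMatching σ τ S κ, P.Extends Q V η ∧ Q.T = t} with hA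
  have hAne : A.Nonempty := ⟨P.T, P, Extends.refl P V η, rfl⟩
  have hAb : BddAbove A := by
    refine ⟨2 * Fintype.card X, ?_⟩
    rintro t ⟨Q, -, rfl⟩
    exact_mod_cast Q.T_le_two_mul hκ4
  obtain ⟨Q, hPQ, hQ⟩ := Nat.sSup_mem hAne hAb
  refine ⟨Q, hPQ, ?_⟩
  have hcD : (Q.D.card : ℝ) + P.T ≤ P.D.card + Q.T := by exact_mod_cast hPQ.card_D
  have hcR : (Q.R.card : ℝ) + P.T ≤ P.R.card + Q.T := by exact_mod_cast hPQ.card_R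
  by_cases h1 : ∀ c, GoodAt σ W c → κ * F.card < (F.filter fun f => σ f c ∈ Q.D).card
  · have := card_add_le_of_saturated hF hκ hPQ.D_subset hσ h1 hD hDc
    linarith
  by_cases h2 : ∀ d, GoodAt τ W d → κ * F.card < (F.filter fun f => τ f d ∈ Q.R).card
  · rw [hXY] at *
    have := card_add_le_of_saturated hF hκ hPQ.R_subset hτ h2 hR hRc
    linarith
  exfalso
  push Not at h1 h2
  obtain ⟨c, hc, hcD⟩ := h1
  obtain ⟨d, hd, hdR⟩ := h2
  obtain ⟨N, hQN, hN⟩ := Q.exists_add_tile hSF hVF hSW hVW hFW hc hd hcD hdR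
  have h3 : N.T ≤ sSup A := le_csSup hAb ⟨N, hPQ.trans hQN, rfl⟩
  have := hF.card_pos
  omega

end TileMatching

/-! ### Amenability implies conjugacy -/

theorem IsAmenable.exists_boundary_le {Γ : Type*} [Group Γ] (h : IsAmenable Γ) (K : Finset Γ)
    {ε : ℝ} (hε : 0 < ε) : ∃ F : Finset Γ, F.Nonempty ∧
      ∀ k ∈ K, (boundary (fun f => k * f) F : ℝ) ≤ ε * F.card := by
  classical
  obtain ⟨F, hF, hK⟩ := h K ε hε
  refine ⟨F, hF, fun k hk => le_trans ?_ (hK k hk)⟩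
  rw [Nat.cast_le, boundary]
  refine Finset.card_le_card_of_injOn (fun f => k * f) (fun f hf => ?_)
    fun f _ g _ h => mul_left_cancel h
  obtain ⟨h1, h2⟩ := mem_exits.1 hf
  simp only [Finset.mem_coe, Finset.mem_symmDiff]
  exact Or.inl ⟨by simpa using Finset.smul_mem_smul_finset (a := k) h1, h2⟩

theorem isNull_of_forall_eventually_le {ω : Ultrafilter ℕ} {P : ∀ n : ℕ, Fin (n + 1) → Prop}
    (h : ∀ δ : ℝ, 0 < δ → ∀ᶠ n in (ω : Filter ℕ), ∃ E : Finset (Fin (n + 1)),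
      (∀ x, P n x → x ∈ E) ∧ (E.card : ℝ) ≤ δ * ((n : ℝ) + 1)) : IsNull ω P := by
  classical
  refine tendsto_order.2 ⟨fun a ha => Eventually.of_forall fun n => lt_of_lt_of_le ha
    (by positivity), fun a ha => ?_⟩
  filter_upwards [h (a / 2) (by linarith)] with n ⟨E, hE, hEc⟩
  rw [div_lt_iff₀ (by positivity)]
  have h1 : ((Finset.univ.filter (P n)).card : ℝ) ≤ E.card := by
    exact_mod_cast Finset.card_le_card fun x hx => hE x (Finset.mem_filter.1 hx).2
  have h2 : (0 : ℝ) < (n : ℝ) + 1 := by positivity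
  nlinarith

/-- Along two sofic sequences of an amenable group there are matchings by tiles that are as large
as desired. -/
theorem exists_tileMatching {Γ : Type*} [Group Γ] (hΓ : IsAmenable Γ) {ω : Ultrafilter ℕ}
    {σ τ : ∀ n : ℕ, Γ → Equiv.Perm (Fin (n + 1))} (hσ : IsSoficSeq ω σ) (hτ : IsSoficSeq ω τ)
    (S : Finset Γ) {κ : ℝ} (hκ : 0 < κ) (hκ4 : κ ≤ 1 / 4) (j : ℕ) (V : Finset Γ) {η : ℝ}
    (hη : 0 < η) : ∀ᶠ n in (ω : Filter ℕ), ∃ P : TileMatching (σ n) (τ n) S κ,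
      (∀ s ∈ V, (boundary (σ n s) P.D : ℝ) ≤ η * ((n : ℝ) + 1)) ∧
      (∀ s ∈ V, (boundary (τ n s) P.R : ℝ) ≤ η * ((n : ℝ) + 1)) ∧
      ((1 - κ) * ((n : ℝ) + 1) < P.D.card ∨ (1 - κ) * ((n : ℝ) + 1) < P.R.card ∨
        j * (κ ^ 2 / 2) * ((n : ℝ) + 1) ≤ P.T) := by
  classical
  induction j generalizing V η with
  | zero =>
    refine Eventually.of_forall fun n => ⟨TileMatching.empty _ _ _ _, ?_, ?_, ?_⟩
    · intro s _
      simp only [TileMatching.empty, boundary_empty, Nat.cast_zero]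
      positivity
    · intro s _
      simp only [TileMatching.empty, boundary_empty, Nat.cast_zero]
      positivity
    · simp [TileMatching.empty]
  | succ j ih =>
    -- The shape used last is chosen first: the earlier stages must produce covers almost invariant
    -- under `F`, so the induction hypothesis is applied to `V ∪ F`. New tiles have total size at
    -- most `2 * (n + 1)`, so the density `η / 4` costs at most half of the allowed boundary.
    obtain ⟨F, hF, hFb⟩ := hΓ.exists_boundary_le (S ∪ V) (ε := min κ (η / 4))
      (lt_min hκ (by linarith))
    have hη₂ : 0 < min (η / 2) (κ ^ 2 / 4) := lt_min (by linarith) (by positivity)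
    filter_upwards [ih (V ∪ F) hη₂,
      (hσ.isNull_not_goodAt (S ∪ V ∪ F)).eventually_le (δ := κ / 4) (by linarith),
      (hτ.isNull_not_goodAt (S ∪ V ∪ F)).eventually_le (δ := κ / 4) (by linarith)]
      with n ⟨P, hPD, hPR, hP⟩ hbσ hbτ
    have hn : (0 : ℝ) < (n : ℝ) + 1 := by positivity
    have hcard : (Fintype.card (Fin (n + 1)) : ℝ) = (n : ℝ) + 1 := by simp
    have hle₁ : min (η / 2) (κ ^ 2 / 4) * ((n : ℝ) + 1) ≤ η / 2 * ((n : ℝ) + 1) := by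
      gcongr; exact min_le_left _ _
    have hle₂ : min (η / 2) (κ ^ 2 / 4) * ((n : ℝ) + 1) ≤ κ ^ 2 / 4 * ((n : ℝ) + 1) := by
      gcongr; exact min_le_right _ _
    have hV₁ : ∀ s ∈ V, (boundary (σ n s) P.D : ℝ) ≤ η / 2 * ((n : ℝ) + 1) := fun s hs =>
      (hPD s (Finset.mem_union_left _ hs)).trans hle₁
    have hV₂ : ∀ s ∈ V, (boundary (τ n s) P.R : ℝ) ≤ η / 2 * ((n : ℝ) + 1) := fun s hs =>
      (hPR s (Finset.mem_union_left _ hs)).trans hle₁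
    have hηle : η / 2 * ((n : ℝ) + 1) ≤ η * ((n : ℝ) + 1) := by gcongr; linarith
    by_cases h1 : (1 - κ) * ((n : ℝ) + 1) < P.D.card
    · exact ⟨P, fun s hs => (hV₁ s hs).trans hηle, fun s hs => (hV₂ s hs).trans hηle, Or.inl h1⟩
    by_cases h2 : (1 - κ) * ((n : ℝ) + 1) < P.R.card
    · exact ⟨P, fun s hs => (hV₁ s hs).trans hηle, fun s hs => (hV₂ s hs).trans hηle,
        Or.inr (Or.inl h2)⟩
    have hT := (hP.resolve_left h1).resolve_left h2
    push Not at h1 h2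
    obtain ⟨Q, hPQ, hQT⟩ := P.exists_extends (F := F) (V := V) (W := S ∪ V ∪ F) (η := η / 4)
      rfl hκ hκ4 hF
      (fun s hs => (hFb s (Finset.mem_union_left _ hs)).trans (by gcongr; exact min_le_left _ _))
      (fun s hs => (hFb s (Finset.mem_union_right _ hs)).trans (by gcongr; exact min_le_right _ _))
      (fun s hs => by simp [hs]) (fun s hs => by simp [hs]) (fun s hs => by simp [hs])
      (by rw [hcard]; convert hbσ) (by rw [hcard]; convert hbτ)
      (fun f hf => by
        rw [hcard]; exact (hPD f (Finset.mem_union_right _ hf)).trans hle₂)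
      (fun f hf => by
        rw [hcard]; exact (hPR f (Finset.mem_union_right _ hf)).trans hle₂)
      (by rw [hcard]; exact h1) (by rw [hcard]; exact h2)
    rw [hcard] at hQT
    have hQ2 := Q.T_le_two_mul hκ4
    rw [hcard] at hQ2
    have hP0 : (0 : ℝ) ≤ P.T := Nat.cast_nonneg _
    have hinc : η / 4 * ((Q.T : ℝ) - P.T) ≤ η / 2 * ((n : ℝ) + 1) := by
      have : η / 4 * ((Q.T : ℝ) - P.T) ≤ η / 4 * (2 * ((n : ℝ) + 1)) := by gcongr; linarith
      linarith
    refine ⟨Q, fun s hs => ?_, fun s hs => ?_, Or.inr (Or.inr ?_)⟩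
    · linarith [hPQ.boundary_D s hs, hV₁ s hs]
    · linarith [hPQ.boundary_R s hs, hV₂ s hs]
    · push_cast
      linarith

open scoped Classical in
-- The matching is the graph of a partial injection and extends arbitrarily to a bijection.
-- Intertwining can fail only at unmatched points and at exits of the matching.
theorem TileMatching.exists_equiv {Γ X Y : Type*} [Fintype X] [Fintype Y]
    (hXY : Fintype.card X = Fintype.card Y) {σ : Γ → Equiv.Perm X} {τ : Γ → Equiv.Perm Y}
    {S : Finset Γ} {κ : ℝ} (P : TileMatching σ τ S κ) :
    ∃ p : X ≃ Y, ∀ s, (Finset.univ.filter fun x => p (σ s x) ≠ τ s (p x)).card + P.M.card ≤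
      Fintype.card X + boundary (Prod.map (σ s) (τ s)) P.M := by
  set A : Finset X := P.M.image Prod.fst with hA
  have hex : ∀ x : X, ∃ y : Y, x ∈ A → (x, y) ∈ P.M := by
    intro x
    by_cases hx : x ∈ A
    · obtain ⟨q, hq, rfl⟩ := Finset.mem_image.1 hx
      exact ⟨q.2, fun _ => hq⟩
    · have : Nonempty Y := by
        rw [← Fintype.card_pos_iff, ← hXY]
        exact Fintype.card_pos_iff.2 ⟨x⟩
      exact ⟨this.some, fun h => absurd h hx⟩
  choose f hf using hex
  have hinj : Set.InjOn f A := fun x hx y hy hxy => by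
    have := P.snd_inj (hf x hx) (hf y hy) hxy
    exact congrArg Prod.fst this
  obtain ⟨g, hg⟩ := Finset.exists_equiv_extend_of_card_eq (t := (Finset.univ : Finset Y))
    (by rw [hXY, Finset.card_univ]) (Finset.subset_univ _) hinj
  let p : X ≃ Y := g.trans (Equiv.subtypeUnivEquiv fun y => Finset.mem_univ y)
  have hp : ∀ q ∈ P.M, p q.1 = q.2 := by
    intro q hq
    have hqA : q.1 ∈ A := Finset.mem_image_of_mem _ hq
    have h1 : p q.1 = f q.1 := hg _ hqA
    rw [h1]
    have := P.fst_inj (hf _ hqA) hq rfl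
    exact congrArg Prod.snd this
  refine ⟨p, fun s => ?_⟩
  have hAc : A.card = P.M.card := Finset.card_image_of_injOn P.fst_inj
  have h1 : (Finset.univ.filter fun x => p (σ s x) ≠ τ s (p x)).card ≤
      Aᶜ.card + boundary (Prod.map (σ s) (τ s)) P.M := by
    refine (Finset.card_le_card (t := Aᶜ ∪ (exits (Prod.map (σ s) (τ s)) P.M).image Prod.fst)
      fun x hx => ?_).trans ((Finset.card_union_le _ _).trans
        (Nat.add_le_add_left Finset.card_image_le _))
    by_cases hxA : x ∈ A
    · obtain ⟨q, hq, rfl⟩ := Finset.mem_image.1 hxA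
      refine Finset.mem_union_right _ (Finset.mem_image_of_mem _ (mem_exits.2 ⟨hq, fun h => ?_⟩))
      refine (Finset.mem_filter.1 hx).2 ?_
      rw [hp q hq]
      exact hp _ h
    · exact Finset.mem_union_left _ (Finset.mem_compl.2 hxA)
  have h2 := Finset.card_compl_add_card A
  omega

open scoped Classical in
/-- Two sofic sequences of an amenable group are approximately conjugate on finite sets. -/
theorem exists_approx_conj {Γ : Type*} [Group Γ] (hΓ : IsAmenable Γ) {ω : Ultrafilter ℕ}
    {σ τ : ∀ n : ℕ, Γ → Equiv.Perm (Fin (n + 1))} (hσ : IsSoficSeq ω σ) (hτ : IsSoficSeq ω τ)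
    (S : Finset Γ) {ε : ℝ} (hε : 0 < ε) : ∀ᶠ n in (ω : Filter ℕ), ∃ p : Equiv.Perm (Fin (n + 1)),
      ∀ s ∈ S, ((Finset.univ.filter fun x => p (σ n s x) ≠ τ n s (p x)).card : ℝ) ≤
        ε * ((n : ℝ) + 1) := by
  -- Unmatched points cost `3 * κ`, and exits cost `3 * κ` times a total size of at most `2 * (n +
  -- 1)`: together `9 * κ`.
  set κ : ℝ := min (1 / 4) (ε / 9) with hκdef
  have hκ : 0 < κ := lt_min (by norm_num) (by linarith)
  have hκ4 : κ ≤ 1 / 4 := min_le_left _ _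
  have hκε : 9 * κ ≤ ε := by linarith [min_le_right (1 / 4) (ε / 9)]
  -- So many stages would push the total size beyond its bound, so one of the two covers must be
  -- nearly full.
  obtain ⟨j, hj⟩ := exists_nat_gt (2 / (κ ^ 2 / 2))
  rw [div_lt_iff₀ (by positivity)] at hj
  filter_upwards [exists_tileMatching hΓ hσ hτ S hκ hκ4 j ∅ one_pos] with n ⟨P, _, _, hP⟩
  have hn : (0 : ℝ) < (n : ℝ) + 1 := by positivity
  have hT2 : (P.T : ℝ) ≤ 2 * ((n : ℝ) + 1) := by simpa using P.T_le_two_mul hκ4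
  have hDT : (P.D.card : ℝ) ≤ P.T := by exact_mod_cast P.card_D
  have hRT : (P.R.card : ℝ) ≤ P.T := by exact_mod_cast P.card_R
  have hT : (1 - κ) * ((n : ℝ) + 1) ≤ P.T := by
    rcases hP with h | h | h
    · linarith
    · linarith
    · have := mul_lt_mul_of_pos_right hj hn
      linarith
  have hM : (1 - 3 * κ) * ((n : ℝ) + 1) ≤ P.M.card := by
    refine le_trans ?_ P.le_card_M
    have h1 : (1 - 2 * κ) * ((1 - κ) * ((n : ℝ) + 1)) ≤ (1 - 2 * κ) * P.T :=
      mul_le_mul_of_nonneg_left hT (by linarith)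
    have h2 : 0 ≤ κ ^ 2 * ((n : ℝ) + 1) := by positivity
    linarith
  obtain ⟨p, hp⟩ := P.exists_equiv rfl
  refine ⟨p, fun s hs => ?_⟩
  have h1 : ((Finset.univ.filter fun x => p (σ n s x) ≠ τ n s (p x)).card : ℝ) + P.M.card ≤
      ((n : ℝ) + 1) + boundary (Prod.map (σ n s) (τ n s)) P.M := by
    have := hp s
    rw [Fintype.card_fin] at this
    exact_mod_cast this
  have h2 := P.boundary_M s hs
  have h3 : 3 * κ * P.T ≤ 3 * κ * (2 * ((n : ℝ) + 1)) := by gcongr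
  have h4 : 9 * κ * ((n : ℝ) + 1) ≤ ε * ((n : ℝ) + 1) := by gcongr
  linarith

/-- Any two faithful embeddings of a finitely generated amenable group are conjugate. -/
theorem IsAmenable.areConjugate {Γ : Type*} [Group Γ] [Group.FG Γ] (hΓ : IsAmenable Γ)
    {ω : Ultrafilter ℕ} {φ ψ : Γ →* SoficGroup ω} (hφ : IsFaithfulEmbedding ω φ)
    (hψ : IsFaithfulEmbedding ω ψ) : AreConjugate φ ψ := by
  classical
  obtain ⟨σ, hσ, hφσ⟩ := hφ.exists_isSoficSeq
  obtain ⟨τ, hτ, hψτ⟩ := hψ.exists_isSoficSeq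
  obtain ⟨S, hS⟩ := (Group.FG.out : (⊤ : Subgroup Γ).FG)
  let cost (n : ℕ) (p : Equiv.Perm (Fin (n + 1))) : ℕ :=
    ∑ s ∈ S, (Finset.univ.filter fun x => p (σ n s x) ≠ τ n s (p x)).card
  -- A cost minimiser does not depend on the tolerance, so a single sequence `p` serves every `δ`
  -- and no diagonal argument is needed.
  choose p hp using fun n => Finite.exists_min (cost n)
  have hnull : ∀ s ∈ S, IsNull ω fun n x => p n (σ n s x) ≠ τ n s (p n x) := by
    intro s hs
    refine isNull_of_forall_eventually_le fun δ hδ => ?_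
    have hSc : (0 : ℝ) < S.card := by exact_mod_cast Finset.card_pos.2 ⟨s, hs⟩
    filter_upwards [exists_approx_conj hΓ hσ hτ S (ε := δ / S.card) (by positivity)]
      with n ⟨q, hq⟩
    refine ⟨Finset.univ.filter fun x => p n (σ n s x) ≠ τ n s (p n x), fun x hx => by simpa using hx,
      ?_⟩
    have h1 : (Finset.univ.filter fun x => p n (σ n s x) ≠ τ n s (p n x)).card ≤ cost n (p n) :=
      Finset.single_le_sum (f := fun s =>
        (Finset.univ.filter fun x => p n (σ n s x) ≠ τ n s (p n x)).card)
        (fun _ _ => Nat.zero_le _) hs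
    have h2 : (cost n q : ℝ) ≤ S.card * (δ / S.card * ((n : ℝ) + 1)) := by
      rw [← nsmul_eq_mul]
      push_cast [cost]
      exact Finset.sum_le_card_nsmul _ _ _ hq
    have h3 : ((Finset.univ.filter fun x => p n (σ n s x) ≠ τ n s (p n x)).card : ℝ) ≤ cost n q := by
      exact_mod_cast h1.trans (hp n q)
    refine (h3.trans h2).trans (le_of_eq ?_)
    field_simp
  refine ⟨(QuotientGroup.mk p)⁻¹, fun γ => ?_⟩
  have heq : φ = (MulAut.conj (QuotientGroup.mk p : SoficGroup ω)⁻¹).toMonoidHom.comp ψ := by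
    refine MonoidHom.eq_of_eqOn_dense hS fun s hs => ?_
    have h1 : (QuotientGroup.mk (p * fun n => σ n s) : SoficGroup ω) =
        QuotientGroup.mk ((fun n => τ n s) * p) :=
      mk_eq_mk_iff.2 ((hnull s hs).mono fun n x hx => hx)
    rw [QuotientGroup.mk_mul, QuotientGroup.mk_mul, ← hφσ, ← hψτ] at h1
    simp only [MonoidHom.comp_apply, MulEquiv.coe_toMonoidHom, MulAut.conj_apply, inv_inv]
    rw [mul_assoc, ← h1, inv_mul_cancel_left]
  have := DFunLike.congr_fun heq γ
  simpa using this

/-! ### Blow-ups by blocks -/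

/-- The inclusion of `N / a` consecutive blocks of `a` points into `N` points. -/
def blockEmbedding (a N : ℕ) : Fin (N / a) × Fin a ↪ Fin N :=
  finProdFinEquiv.toEmbedding.trans (Fin.castLEEmb (Nat.div_mul_le_self N a))

theorem blockEmbedding_val (a N : ℕ) (z : Fin (N / a) × Fin a) :
    (blockEmbedding a N z : ℕ) = z.2 + a * z.1 := rfl

/-- The permutation of `N` points that acts as `g` on each of `N / a` blocks of `a` points. -/
noncomputable def blockPerm {a : ℕ} (N : ℕ) (g : Equiv.Perm (Fin a)) : Equiv.Perm (Fin N) :=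
  Equiv.Perm.viaEmbedding (Equiv.prodCongr (Equiv.refl (Fin (N / a))) g) (blockEmbedding a N)

theorem blockPerm_apply {a N : ℕ} (g : Equiv.Perm (Fin a)) (q : Fin (N / a)) (r : Fin a) :
    blockPerm N g (blockEmbedding a N (q, r)) = blockEmbedding a N (q, g r) := by
  rw [blockPerm, Equiv.Perm.viaEmbedding_apply]
  rfl

theorem blockPerm_val_div {a N : ℕ} (g : Equiv.Perm (Fin a)) (x : Fin N) :
    (blockPerm N g x : ℕ) / a = (x : ℕ) / a := by
  by_cases hx : x ∈ Set.range (blockEmbedding a N)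
  · obtain ⟨⟨q, r⟩, rfl⟩ := hx
    have ha : 0 < a := r.pos
    rw [blockPerm_apply, blockEmbedding_val, blockEmbedding_val, Nat.add_mul_div_left _ _ ha,
      Nat.add_mul_div_left _ _ ha, Nat.div_eq_of_lt r.2, Nat.div_eq_of_lt (g r).2]
  · rw [blockPerm, Equiv.Perm.viaEmbedding_apply_of_notMem _ _ _ hx]

open scoped Classical in
-- Densities are the same in every block; the last term pays for the fewer than `a` points outside
-- all blocks.
theorem card_filter_div_le_of_block {a N : ℕ} (ha : 0 < a) (hN : 0 < N) {P : Fin a → Prop}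
    {Q : Fin N → Prop} (h : ∀ q r, Q (blockEmbedding a N (q, r)) → P r) :
    ((Finset.univ.filter Q).card : ℝ) / N ≤ ((Finset.univ.filter P).card : ℝ) / a + (a : ℝ) / N := by
  have h1 : (Finset.univ.filter Q).card ≤ (N / a) * (Finset.univ.filter P).card + a := by
    refine (Finset.card_le_card (t := ((Finset.univ ×ˢ Finset.univ.filter P).map
      (blockEmbedding a N)) ∪ (Finset.univ.map (blockEmbedding a N))ᶜ) fun x hx => ?_).trans
      ((Finset.card_union_le _ _).trans (Nat.add_le_add ?_ ?_))
    · by_cases hxe : x ∈ Finset.univ.map (blockEmbedding a N)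
      · obtain ⟨⟨q, r⟩, -, rfl⟩ := Finset.mem_map.1 hxe
        refine Finset.mem_union_left _ (Finset.mem_map_of_mem _ ?_)
        simpa using h q r (by simpa using hx)
      · exact Finset.mem_union_right _ (Finset.mem_compl.2 hxe)
    · rw [Finset.card_map, Finset.card_product, Finset.card_univ, Fintype.card_fin]
    · rw [Finset.card_compl, Finset.card_map, Finset.card_univ, Fintype.card_prod,
        Fintype.card_fin, Fintype.card_fin, Fintype.card_fin]
      have := Nat.div_add_mod N a
      have := Nat.mod_lt N ha
      have := Nat.mul_comm a (N / a)
      omega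
  have ha' : (0 : ℝ) < a := by exact_mod_cast ha
  have hN' : (0 : ℝ) < N := by exact_mod_cast hN
  have h2 : ((Finset.univ.filter Q).card : ℝ) ≤
      ((N / a : ℕ) : ℝ) * (Finset.univ.filter P).card + a := by exact_mod_cast h1
  have h3 : ((N / a : ℕ) : ℝ) ≤ N / a := Nat.cast_div_le
  rw [div_le_iff₀ hN', add_mul, div_mul_cancel₀ _ hN'.ne']
  have h4 : ((N / a : ℕ) : ℝ) * (Finset.univ.filter P).card ≤
      (N / a : ℝ) * (Finset.univ.filter P).card := by gcongr
  have h5 : (N / a : ℝ) * (Finset.univ.filter P).card =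
      ((Finset.univ.filter P).card : ℝ) / a * N := by ring
  linarith

open scoped Classical in
/-- The density of the `n`-th member of a sequence of subsets of the sets `{0, …, n}`. -/
noncomputable def density (P : ∀ n : ℕ, Fin (n + 1) → Prop) (n : ℕ) : ℝ :=
  ((Finset.univ.filter (P n)).card : ℝ) / ((n : ℝ) + 1)

theorem IsNull.of_block {ω : Ultrafilter ℕ} {m : ℕ → ℕ}
    (hm : Tendsto (fun n => ((m n : ℝ) + 1) / ((n : ℝ) + 1)) (ω : Filter ℕ) (𝓝 0))
    {P Q : ∀ n : ℕ, Fin (n + 1) → Prop}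
    (hP : Tendsto (fun n => density P (m n)) (ω : Filter ℕ) (𝓝 0))
    (h : ∀ n q r, Q n (blockEmbedding (m n + 1) (n + 1) (q, r)) → P (m n) r) : IsNull ω Q := by
  have hsum := hP.add hm
  rw [add_zero] at hsum
  refine squeeze_zero (fun n => by positivity) (fun n => ?_) hsum
  have := card_filter_div_le_of_block (Nat.succ_pos (m n)) (Nat.succ_pos n) (h n)
  push_cast at this
  exact this

/-- Countably many sequences of null sets along `ω` are null along a common ordinary sequence. -/
theorem exists_seq_density_tendsto {ι : Type*} [Countable ι] {ω : Ultrafilter ℕ}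
    {P : ι → ∀ n : ℕ, Fin (n + 1) → Prop} (h : ∀ i, IsNull ω (P i)) :
    ∃ u : ℕ → ℕ, ∀ i, Tendsto (fun k => density (P i) (u k)) atTop (𝓝 0) := by
  -- For countable `ι` the product `ι → ℝ` is first countable, so the comap of `𝓝 0` is countably
  -- generated and has a sequence tending to it.
  let Φ : ℕ → ι → ℝ := fun n i => density (P i) n
  have hΦ : Tendsto Φ (ω : Filter ℕ) (𝓝 0) := tendsto_pi_nhds.2 h
  have : NeBot (comap Φ (𝓝 0)) := neBot_of_le (tendsto_iff_comap.1 hΦ)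
  obtain ⟨u, hu⟩ := exists_seq_tendsto (comap Φ (𝓝 0))
  exact ⟨u, tendsto_pi_nhds.1 (tendsto_comap.comp hu)⟩

/-- The diagonal choice: `k n` is the largest index up to `n` whose condition holds at `n`.
Non-principality makes `n` exceed any constant, so `k` is unbounded along `ω`. -/
theorem exists_tendsto_atTop_of_forall_eventually {ω : Ultrafilter ℕ}
    (hω : (ω : Filter ℕ) ≤ cofinite) {G : ℕ → ℕ → Prop}
    (hG : ∀ k, ∀ᶠ n in (ω : Filter ℕ), G k n) :
    ∃ k : ℕ → ℕ, Tendsto k (ω : Filter ℕ) atTop ∧ ∀ᶠ n in (ω : Filter ℕ), G (k n) n := by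
  classical
  rw [Nat.cofinite_eq_atTop] at hω
  refine ⟨fun n => Nat.findGreatest (fun k => G k n) n, tendsto_atTop.2 fun K => ?_, ?_⟩
  · filter_upwards [hG K, hω (eventually_ge_atTop K)] with n h1 h2
    exact Nat.le_findGreatest h2 h1
  · filter_upwards [hG 0] with n h
    exact Nat.findGreatest_spec (P := fun k => G k n) (Nat.zero_le n) h

/-! ### Conjugacy implies hyperfiniteness -/

open scoped Classical in
/-- A partition into at most `K`-element classes such that every element of `S` moves at most a
proportion `ε` of the points to another class. -/
def IsHyperfinite {Γ X : Type*} [Fintype X] (σ : Γ → Equiv.Perm X) (S : Finset Γ) (ε : ℝ)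
    (K : ℕ) : Prop :=
  ∃ q : X → ℕ, (∀ l, (Finset.univ.filter fun x => q x = l).card ≤ K) ∧
    ∀ s ∈ S, ((Finset.univ.filter fun x => q (σ s x) ≠ q x).card : ℝ) ≤ ε * Fintype.card X

theorem countable_of_fg (Γ : Type*) [Group Γ] [Group.FG Γ] : Countable Γ := by
  obtain ⟨S, hS, φ, hφ⟩ := Group.fg_iff_exists_freeGroup_hom_surjective.1 ‹Group.FG Γ›
  have : Countable S := hS.countable
  exact hφ.countable

/-- The blow-up of a sofic sequence by blocks of slowly growing size is a sofic sequence. -/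
theorem IsSoficSeq.block {Γ : Type*} [Group Γ] {ω : Ultrafilter ℕ}
    {σ : ∀ n : ℕ, Γ → Equiv.Perm (Fin (n + 1))} {m : ℕ → ℕ}
    (hm : Tendsto (fun n => ((m n : ℝ) + 1) / ((n : ℝ) + 1)) (ω : Filter ℕ) (𝓝 0))
    (hmul : ∀ g h, Tendsto (fun n => density (fun n x => σ n g (σ n h x) ≠ σ n (g * h) x) (m n))
      (ω : Filter ℕ) (𝓝 0))
    (hfree : ∀ g, g ≠ 1 → Tendsto (fun n => density (fun n x => σ n g x = x) (m n))
      (ω : Filter ℕ) (𝓝 0)) :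
    IsSoficSeq ω fun n γ => blockPerm (n + 1) (σ (m n) γ) where
  mul g h := IsNull.of_block hm (hmul g h) fun n q r hqr => by
    rw [blockPerm_apply, blockPerm_apply, blockPerm_apply] at hqr
    exact fun hcon => hqr (by rw [hcon])
  free g hg := IsNull.of_block hm (hfree g hg) fun n q r hqr => by
    rw [blockPerm_apply] at hqr
    exact congrArg Prod.snd ((blockEmbedding _ _).injective hqr)

/-- The classes are the images of the blocks under `p`, with the leftover points as one further,
smaller class. Block permutations preserve the labels, so a label changes only where the conjugacy
fails. -/
theorem isHyperfinite_of_conj_block {Γ : Type*} {n a : ℕ} (ha : 0 < a)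
    {σ : Γ → Equiv.Perm (Fin n)} {ρ : Γ → Equiv.Perm (Fin a)} (p : Equiv.Perm (Fin n))
    {S : Finset Γ} {ε : ℝ}
    (h : ∀ s ∈ S, ((Finset.univ.filter fun x => σ s (p x) ≠ p (blockPerm n (ρ s) x)).card : ℝ) ≤
      ε * n) : IsHyperfinite σ S ε a := by
  classical
  refine ⟨fun x => (p.symm x : ℕ) / a, fun l => ?_, fun s hs => ?_⟩
  · refine (Finset.card_le_card_of_injOn (t := Finset.Ico (a * l) (a * l + a))
      (fun x => (p.symm x : ℕ)) (fun x hx => ?_) ?_).trans (by simp)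
    · have hx' : (p.symm x : ℕ) / a = l := by simpa using hx
      have h1 := Nat.div_add_mod (p.symm x : ℕ) a
      have h2 := Nat.mod_lt (p.symm x : ℕ) ha
      rw [hx'] at h1
      simp only [Finset.coe_Ico, Set.mem_Ico]
      omega
    · exact fun x _ y _ hxy => p.symm.injective (Fin.ext hxy)
  · rw [Fintype.card_fin]
    refine le_trans ?_ (h s hs)
    rw [Nat.cast_le]
    refine Finset.card_le_card_of_injOn p.symm (fun x hx => ?_) p.symm.injective.injOn
    simp only [Finset.coe_filter, Finset.mem_univ, true_and, Set.mem_ofPred_eq] at hx ⊢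
    intro hcon
    apply hx
    rw [Equiv.apply_symm_apply] at hcon
    rw [hcon, Equiv.symm_apply_apply, blockPerm_val_div]

/-- If all faithful embeddings are conjugate, then sofic sequences are hyperfinite. -/
theorem eventually_isHyperfinite {Γ : Type*} [Group Γ] [Group.FG Γ] {ω : Ultrafilter ℕ}
    (hω : (ω : Filter ℕ) ≤ cofinite)
    (hconj : ∀ φ ψ : Γ →* SoficGroup ω, IsFaithfulEmbedding ω φ → IsFaithfulEmbedding ω ψ →
      AreConjugate φ ψ)
    {σ : ∀ n : ℕ, Γ → Equiv.Perm (Fin (n + 1))} (hσ : IsSoficSeq ω σ)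
    (S : Finset Γ) {ε : ℝ} (hε : 0 < ε) :
    ∃ K : ℕ, ∀ᶠ n in (ω : Filter ℕ), IsHyperfinite (σ n) S ε K := by
  classical
  by_contra hcon
  push Not at hcon
  have := countable_of_fg Γ
  obtain ⟨u, hu⟩ := exists_seq_density_tendsto (ω := ω) (ι := (Γ × Γ) ⊕ {g : Γ // g ≠ 1})
    (P := Sum.elim (fun q n x => σ n q.1 (σ n q.2 x) ≠ σ n (q.1 * q.2) x)
      (fun g n x => σ n g.1 x = x))
    (by rintro (q | g); exacts [hσ.mul q.1 q.2, hσ.free g.1 g.2])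
  -- The block size `u (k n) + 1` is to be negligible against `n + 1` and yet not a valid class
  -- bound for `σ n`. If no uniform bound exists, the ultrafilter makes each candidate fail
  -- eventually.
  obtain ⟨k, hk, hkG⟩ := exists_tendsto_atTop_of_forall_eventually hω
    (G := fun k n => (u k + 1) * (k + 1) ≤ n + 1 ∧ ¬ IsHyperfinite (σ n) S ε (u k + 1))
    (fun k => by
      have h1 : ∀ᶠ n in (ω : Filter ℕ), (u k + 1) * (k + 1) ≤ n :=
        (hω.trans Nat.cofinite_eq_atTop.le) (eventually_ge_atTop _)
      filter_upwards [h1, hcon (u k + 1)] with n h1 h2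
      exact ⟨by omega, h2⟩)
  set m : ℕ → ℕ := fun n => u (k n) with hmdef
  have hm : Tendsto (fun n => ((m n : ℝ) + 1) / ((n : ℝ) + 1)) (ω : Filter ℕ) (𝓝 0) := by
    have h1 : Tendsto (fun n => 1 / ((k n : ℝ) + 1)) (ω : Filter ℕ) (𝓝 0) :=
      tendsto_one_div_add_atTop_nhds_zero_nat.comp hk
    refine squeeze_zero' (Eventually.of_forall fun n => by positivity) ?_ h1
    filter_upwards [hkG] with n hn
    have h2 : ((m n : ℝ) + 1) * ((k n : ℝ) + 1) ≤ (n : ℝ) + 1 := by exact_mod_cast hn.1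
    rw [div_le_div_iff₀ (by positivity) (by positivity)]
    linarith
  have hτ : IsSoficSeq ω fun n γ => blockPerm (n + 1) (σ (m n) γ) :=
    IsSoficSeq.block hm (fun g h => (hu (Sum.inl (g, h))).comp hk)
      (fun g hg => (hu (Sum.inr ⟨g, hg⟩)).comp hk)
  obtain ⟨φ, hφ, hφσ⟩ := hσ.exists_embedding
  obtain ⟨ψ, hψ, hψτ⟩ := hτ.exists_embedding
  obtain ⟨g, hg⟩ := hconj φ ψ hφ hψ
  obtain ⟨p, rfl⟩ := QuotientGroup.mk_surjective g
  have hnull : IsNull ω fun n x => ∃ s ∈ S,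
      σ n s (p n x) ≠ p n (blockPerm (n + 1) (σ (m n) s) x) := by
    refine IsNull.exists_mem S fun s _ => ?_
    have h1 := hg s
    rw [eq_mul_inv_iff_mul_eq, hφσ, hψτ, ← QuotientGroup.mk_mul, ← QuotientGroup.mk_mul] at h1
    exact (mk_eq_mk_iff.1 h1).mono fun n x hx => hx
  obtain ⟨n, hn₁, hn₂⟩ := (hkG.and (hnull.eventually_le hε)).exists
  refine hn₁.2 (isHyperfinite_of_conj_block (ρ := σ (m n)) (Nat.succ_pos _) (p n)
    fun s hs => ?_)
  push_cast
  refine le_trans ?_ hn₂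
  rw [Nat.cast_le]
  refine Finset.card_le_card fun x hx => ?_
  simp only [Finset.mem_filter, Finset.mem_univ, true_and] at hx ⊢
  exact ⟨s, hs, hx⟩

/-! ### From hyperfiniteness to Følner sets -/

open scoped Classical in
/-- Some class of a partition with small boundary has small boundary and contains no bad point. -/
theorem IsHyperfinite.exists_class {Γ X : Type*} [Fintype X] [Nonempty X]
    {σ : Γ → Equiv.Perm X} {S : Finset Γ} {ε δ η : ℝ} {K : ℕ} (h : IsHyperfinite σ S ε K)
    {B : Finset X} (hB : (B.card : ℝ) ≤ δ * Fintype.card X) (hη : η < 1)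
    (hε : S.card * ε + K * δ ≤ η) :
    ∃ P : Finset X, P.Nonempty ∧ P.card ≤ K ∧ Disjoint P B ∧
      ((∑ s ∈ S, boundary (σ s) P : ℕ) : ℝ) ≤ η * P.card := by
  obtain ⟨q, hqK, hqS⟩ := h
  set C : ℕ → Finset X := fun l => Finset.univ.filter fun x => q x = l with hC
  set I : Finset ℕ := Finset.univ.image q with hI
  have hfib : ∀ E : Finset X, ∑ l ∈ I, (E.filter fun x => q x = l).card = E.card := fun E =>
    (Finset.card_eq_sum_card_fiberwise fun x _ => Finset.mem_image_of_mem q (Finset.mem_univ x)).symm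
  have hbdry : ∀ s, ∑ l ∈ I, boundary (σ s) (C l) =
      (Finset.univ.filter fun x => q (σ s x) ≠ q x).card := by
    intro s
    rw [← hfib]
    refine Finset.sum_congr rfl fun l _ => ?_
    rw [boundary]
    congr 1
    ext x
    simp only [mem_exits, hC, Finset.mem_filter, Finset.mem_univ, true_and]
    constructor
    · rintro ⟨rfl, h2⟩
      exact ⟨h2, rfl⟩
    · rintro ⟨h1, rfl⟩
      exact ⟨rfl, h1⟩
  -- Each bad point is charged `K`. A class has at most `K` points and `η < 1`, so a class meeting
  -- this average bound cannot afford a bad point.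
  have hsum : ∑ l ∈ I, (((∑ s ∈ S, boundary (σ s) (C l) : ℕ) : ℝ) +
      K * (B.filter fun x => q x = l).card) ≤ ∑ l ∈ I, η * (C l).card := by
    have h1 : ∑ l ∈ I, ((C l).card : ℝ) = Fintype.card X := by
      rw [← Finset.card_univ]
      exact_mod_cast hfib Finset.univ
    have h2 : ∑ l ∈ I, ((B.filter fun x => q x = l).card : ℝ) = B.card := by
      exact_mod_cast hfib B
    have h3 : ∑ l ∈ I, ((∑ s ∈ S, boundary (σ s) (C l) : ℕ) : ℝ) ≤
        S.card * (ε * Fintype.card X) := by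
      have h4 : ∑ l ∈ I, ((∑ s ∈ S, boundary (σ s) (C l) : ℕ) : ℝ) =
          ∑ s ∈ S, ((Finset.univ.filter fun x => q (σ s x) ≠ q x).card : ℝ) := by
        push_cast
        rw [Finset.sum_comm]
        exact Finset.sum_congr rfl fun s _ => by exact_mod_cast hbdry s
      rw [h4, ← nsmul_eq_mul]
      exact Finset.sum_le_card_nsmul _ _ _ hqS
    rw [Finset.sum_add_distrib, ← Finset.mul_sum, ← Finset.mul_sum, h1, h2]
    have h5 : (K : ℝ) * B.card ≤ K * (δ * Fintype.card X) := by gcongr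
    have h6 := mul_le_mul_of_nonneg_right hε (Nat.cast_nonneg (α := ℝ) (Fintype.card X))
    linarith
  obtain ⟨l, hl, hle⟩ := Finset.exists_le_of_sum_le (Finset.univ_nonempty.image q) hsum
  obtain ⟨x, -, hx⟩ := Finset.mem_image.1 hl
  have hne : (C l).Nonempty := ⟨x, by simp [hC, hx]⟩
  have hpos : (0 : ℝ) < (C l).card := by exact_mod_cast hne.card_pos
  have hbad0 : (0 : ℝ) ≤ K * (B.filter fun x => q x = l).card := by positivity
  have hbd0 : (0 : ℝ) ≤ ((∑ s ∈ S, boundary (σ s) (C l) : ℕ) : ℝ) := Nat.cast_nonneg _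
  refine ⟨C l, hne, hqK l, ?_, by linarith⟩
  rw [Finset.disjoint_left]
  intro y hy hyB
  have h1 : 1 ≤ (B.filter fun x => q x = l).card :=
    Finset.card_pos.2 ⟨y, Finset.mem_filter.2 ⟨hyB, (Finset.mem_filter.1 hy).2⟩⟩
  have h2 : (K : ℝ) * 1 ≤ K * (B.filter fun x => q x = l).card := by
    gcongr
    exact_mod_cast h1
  have h3 : ((C l).card : ℝ) ≤ K := by exact_mod_cast hqK l
  nlinarith

open scoped Classical in
/-- The group elements that lead from `x` to a point of `P` along `S`-paths of length at most `j`
inside `P`. -/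
noncomputable def pathElements {Γ X : Type*} [Group Γ] (σ : Γ → Equiv.Perm X) (S : Finset Γ)
    (P : Finset X) (x : X) : ℕ → Finset Γ
  | 0 => {1}
  | j + 1 => pathElements σ S P x j ∪
      (S * pathElements σ S P x j).filter fun γ => σ γ x ∈ P

open scoped Classical in
theorem pathElements_subset_pow {Γ X : Type*} [Group Γ] (σ : Γ → Equiv.Perm X) (S : Finset Γ)
    (P : Finset X) (x : X) (j : ℕ) : pathElements σ S P x j ⊆ insert 1 S ^ j := by
  induction j with
  | zero => simp [pathElements]
  | succ j ih =>
    refine Finset.union_subset (ih.trans ?_) ((Finset.filter_subset _ _).trans ?_)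
    · exact Finset.pow_subset_pow_right (Finset.mem_insert_self _ _) (Nat.le_succ j)
    · rw [pow_succ']
      exact Finset.mul_subset_mul (Finset.subset_insert _ _) ih

theorem map_mem_of_mem_pathElements {Γ X : Type*} [Group Γ] {σ : Γ → Equiv.Perm X} {S : Finset Γ}
    {P : Finset X} {x : X} (hx : σ 1 x ∈ P) {j : ℕ} {γ : Γ} (h : γ ∈ pathElements σ S P x j) :
    σ γ x ∈ P := by
  classical
  induction j with
  | zero =>
    rw [pathElements, Finset.mem_singleton] at h
    rwa [h]
  | succ j ih =>
    rcases Finset.mem_union.1 h with h | h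
    · exact ih h
    · exact (Finset.mem_filter.1 h).2

/-- An increasing chain starting from one element cannot grow strictly at each of `K + 1` steps and
still have at most `K` elements. -/
theorem exists_pathElements_stable {Γ X : Type*} [Group Γ] {σ : Γ → Equiv.Perm X} {S : Finset Γ}
    {P : Finset X} {x : X} {K : ℕ} (h : (pathElements σ S P x (K + 1)).card ≤ K) :
    ∃ j ≤ K, pathElements σ S P x (j + 1) = pathElements σ S P x j := by
  classical
  by_contra hcon
  push Not at hcon
  have hcard : ∀ j ≤ K + 1, j + 1 ≤ (pathElements σ S P x j).card := by
    intro j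
    induction j with
    | zero => simp [pathElements]
    | succ j ih =>
      intro hj
      have h1 : pathElements σ S P x j ⊂ pathElements σ S P x (j + 1) :=
        Finset.ssubset_iff_subset_ne.2 ⟨Finset.subset_union_left, (hcon j (by omega)).symm⟩
      have := Finset.card_lt_card h1
      have := ih (by omega)
      omega
  have := hcard (K + 1) le_rfl
  omega

open scoped Classical in
/-- A minimal finite set of good points with small boundary is a copy of a Følner set. -/
theorem exists_boundary_le_of_good {Γ X : Type*} [Group Γ]
    {σ : Γ → Equiv.Perm X} {S : Finset Γ} (hS : ∀ s ∈ S, s⁻¹ ∈ S) {K : ℕ} {η : ℝ}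
    (h : ∃ P : Finset X, P.Nonempty ∧ P.card ≤ K ∧ (∀ x ∈ P, GoodAt σ (insert 1 S ^ (K + 1)) x) ∧
      ((∑ s ∈ S, boundary (σ s) P : ℕ) : ℝ) ≤ η * P.card) :
    ∃ F : Finset Γ, F.Nonempty ∧ ∀ s ∈ S, (boundary (fun f => s * f) F : ℝ) ≤ η * F.card := by
  obtain ⟨P, ⟨hP, hPK, hPgood, hPη⟩, hmin⟩ :=
    WellFounded.has_min (measure (Finset.card (α := X))).wf
      {P : Finset X | P.Nonempty ∧ P.card ≤ K ∧ (∀ x ∈ P, GoodAt σ (insert 1 S ^ (K + 1)) x) ∧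
        ((∑ s ∈ S, boundary (σ s) P : ℕ) : ℝ) ≤ η * P.card} h
  obtain ⟨x, hx⟩ := hP
  set W : Finset Γ := insert 1 S ^ (K + 1) with hW
  have hpow : ∀ j ≤ K + 1, insert 1 S ^ j ⊆ W := fun j hj =>
    Finset.pow_subset_pow_right (Finset.mem_insert_self _ _) hj
  have hSW : S ⊆ W := (Finset.subset_insert 1 S).trans (by simpa using hpow 1 (by omega))
  have h1W : (1 : Γ) ∈ W := hpow 0 (by omega) (by simp)
  have hx1 : σ 1 x ∈ P := by rwa [(hPgood x hx).map_one h1W]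
  have hAW : ∀ j ≤ K + 1, pathElements σ S P x j ⊆ W := fun j hj =>
    (pathElements_subset_pow σ S P x j).trans (hpow j hj)
  have hinj : Set.InjOn (fun γ => σ γ x) (W : Set Γ) := fun g hg k hk =>
    (hPgood x hx).2 g hg k hk
  -- Goodness at `x` embeds the path elements into `P`, which has at most `K` points. The stable set
  -- is the connected component of `x` in `P`, read in Γ.
  obtain ⟨j, hjK, hj⟩ := exists_pathElements_stable (σ := σ) (S := S) (P := P) (x := x) (K := K)
    ((Finset.card_le_card_of_injOn (fun γ => σ γ x)
      (fun γ hγ => map_mem_of_mem_pathElements hx1 hγ)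
      (hinj.mono (by exact_mod_cast hAW (K + 1) le_rfl))).trans hPK)
  set F := pathElements σ S P x j with hF
  have hFW : F ⊆ W := hAW j (by omega)
  have h1F : (1 : Γ) ∈ F := by
    rw [hF]
    clear hFW hF hj hjK
    induction j with
    | zero => simp [pathElements]
    | succ j ih => exact Finset.mem_union_left _ ih
  have hclosed : ∀ s ∈ S, ∀ f ∈ F, σ s (σ f x) ∈ P → s * f ∈ F := by
    intro s hs f hf hsf
    rw [(hPgood x hx).1 s (hSW hs) f (hFW hf)] at hsf
    rw [← hj]
    exact Finset.mem_union_right _ (Finset.mem_filter.2 ⟨Finset.mul_mem_mul hs hf, hsf⟩)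
  set C : Finset X := F.image fun f => σ f x with hC
  have hCP : C ⊆ P := by
    intro y hy
    obtain ⟨f, hf, rfl⟩ := Finset.mem_image.1 hy
    exact map_mem_of_mem_pathElements hx1 hf
  have hCclosed : ∀ s ∈ S, ∀ y ∈ C, σ s y ∈ P → σ s y ∈ C := by
    intro s hs y hy hsy
    obtain ⟨f, hf, rfl⟩ := Finset.mem_image.1 hy
    refine Finset.mem_image.2 ⟨s * f, hclosed s hs f hf hsy, ?_⟩
    exact ((hPgood x hx).1 s (hSW hs) f (hFW hf)).symm
  have hCcard : C.card = F.card :=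
    Finset.card_image_of_injOn (hinj.mono (by exact_mod_cast hFW))
  have hCeq : C = P := by
    by_contra hne
    have hss : C ⊂ P := Finset.ssubset_iff_subset_ne.2 ⟨hCP, hne⟩
    have hcard := Finset.card_sdiff_add_card_eq_card hCP
    have hCpos : 0 < C.card := Finset.card_pos.2 ⟨_, Finset.mem_image_of_mem _ h1F⟩
    have hClt := Finset.card_lt_card hss
    -- No element of `S` joins `C` to the rest of `P`, so the boundaries add up. One of the two
    -- smaller pieces then also has ratio at most `η`, against minimality.
    have hsplit : ∑ s ∈ S, boundary (σ s) C + ∑ s ∈ S, boundary (σ s) (P \ C) ≤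
        ∑ s ∈ S, boundary (σ s) P := by
      rw [← Finset.sum_add_distrib]
      refine Finset.sum_le_sum fun s hs => ?_
      unfold boundary
      rw [← Finset.card_union_of_disjoint]
      · refine Finset.card_le_card (Finset.union_subset (fun y hy => ?_) fun y hy => ?_)
        · obtain ⟨h1, h2⟩ := mem_exits.1 hy
          exact mem_exits.2 ⟨hCP h1, fun h3 => h2 (hCclosed s hs y h1 h3)⟩
        · obtain ⟨h1, h2⟩ := mem_exits.1 hy
          obtain ⟨h1P, h1C⟩ := Finset.mem_sdiff.1 h1
          refine mem_exits.2 ⟨h1P, fun h3 => h1C ?_⟩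
          have h4 : σ s y ∈ C := by
            by_contra h4
            exact h2 (Finset.mem_sdiff.2 ⟨h3, h4⟩)
          -- Symmetry of `S` excludes steps from `P \ C` into `C`: the reverse step would stay in
          -- `C`.
          have h5 : σ s⁻¹ (σ s y) = y := by
            rw [(hPgood y h1P).1 _ (hSW (hS s hs)) s (hSW hs), inv_mul_cancel,
              (hPgood y h1P).map_one h1W]
          have h6 := hCclosed s⁻¹ (hS s hs) _ h4
          rw [h5] at h6
          exact h6 h1P
      · rw [Finset.disjoint_left]
        intro y hy hy'
        exact (Finset.mem_sdiff.1 (mem_exits.1 hy').1).2 (mem_exits.1 hy).1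
    have h1 : η * C.card < ((∑ s ∈ S, boundary (σ s) C : ℕ) : ℝ) := by
      by_contra hcon
      exact hmin C ⟨Finset.card_pos.1 hCpos, by omega, fun y hy => hPgood y (hCP hy),
        not_lt.1 hcon⟩ hClt
    have h2 : η * (P \ C).card < ((∑ s ∈ S, boundary (σ s) (P \ C) : ℕ) : ℝ) := by
      by_contra hcon
      exact hmin (P \ C) ⟨Finset.card_pos.1 (by omega), by omega,
        fun y hy => hPgood y (Finset.mem_sdiff.1 hy).1, not_lt.1 hcon⟩
        (show (P \ C).card < P.card by omega)
    have h3 : ((∑ s ∈ S, boundary (σ s) C : ℕ) : ℝ) + ((∑ s ∈ S, boundary (σ s) (P \ C) : ℕ) : ℝ) ≤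
        ((∑ s ∈ S, boundary (σ s) P : ℕ) : ℝ) := by exact_mod_cast hsplit
    have h4 : ((P \ C).card : ℝ) + C.card = P.card := by exact_mod_cast hcard
    have h5 : η * ((P \ C).card : ℝ) + η * C.card = η * P.card := by rw [← mul_add, h4]
    linarith
  refine ⟨F, ⟨1, h1F⟩, fun s hs => ?_⟩
  rw [← hCcard, hCeq]
  refine le_trans ?_ hPη
  rw [Nat.cast_le]
  refine le_trans ?_ (Finset.single_le_sum (f := fun s => boundary (σ s) P)
    (fun _ _ => Nat.zero_le _) hs)
  refine Finset.card_le_card_of_injOn (fun f => σ f x) (fun f hf => ?_)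
    (hinj.mono fun f hf => hFW (mem_exits.1 hf).1)
  obtain ⟨h1, h2⟩ := mem_exits.1 hf
  exact mem_exits.2 ⟨hCP (Finset.mem_image_of_mem _ h1), fun h3 => h2 (hclosed s hs f h1 h3)⟩

open scoped Classical in
-- The two one-sided differences have equal size because translation preserves cardinality. This
-- accounts for the `ε / 2` in the final choice of `η`.
theorem card_smul_symmDiff {Γ : Type*} [Group Γ] (k : Γ) (F : Finset Γ) :
    ((k • F) ∆ F).card = 2 * boundary (fun f => k * f) F := by
  have h1 : ((k • F) \ F).card = boundary (fun f => k * f) F := by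
    rw [boundary, ← Finset.card_smul_finset k (exits _ F)]
    congr 1
    ext y
    simp only [Finset.mem_sdiff, Finset.mem_smul_finset, mem_exits, smul_eq_mul]
    constructor
    · rintro ⟨⟨f, hf, rfl⟩, h⟩
      exact ⟨f, ⟨hf, h⟩, rfl⟩
    · rintro ⟨f, ⟨hf, h⟩, rfl⟩
      exact ⟨⟨f, hf, rfl⟩, h⟩
  have h2 : (F \ (k • F)).card = ((k • F) \ F).card :=
    Finset.card_sdiff_comm (Finset.card_smul_finset k F).symm
  have h3 : ((k • F) ∆ F).card = ((k • F) \ F).card + (F \ (k • F)).card := by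
    rw [symmDiff_def, Finset.sup_eq_union, Finset.card_union_of_disjoint disjoint_sdiff_sdiff]
  omega

/-- If a sofic group has only one faithful embedding up to conjugacy, then it is amenable. -/
theorem isAmenable_of_forall_areConjugate {Γ : Type*} [Group Γ] [Group.FG Γ] {ω : Ultrafilter ℕ}
    (hω : (ω : Filter ℕ) ≤ cofinite) {φ : Γ →* SoficGroup ω} (hφ : IsFaithfulEmbedding ω φ)
    (hconj : ∀ φ ψ : Γ →* SoficGroup ω, IsFaithfulEmbedding ω φ → IsFaithfulEmbedding ω ψ →
      AreConjugate φ ψ) : IsAmenable Γ := by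
  classical
  intro A ε hε
  obtain ⟨σ, hσ, -⟩ := hφ.exists_isSoficSeq
  set S : Finset Γ := A ∪ A⁻¹ with hSdef
  have hS : ∀ s ∈ S, s⁻¹ ∈ S := by
    intro s hs
    simp only [hSdef, Finset.mem_union, Finset.mem_inv', inv_inv] at hs ⊢
    exact hs.symm
  set η : ℝ := min (ε / 2) (1 / 2) with hη
  have hηpos : 0 < η := lt_min (by linarith) (by norm_num)
  have hη1 : η < 1 := (min_le_right _ _).trans_lt (by norm_num)
  have hηε : 2 * η ≤ ε := by linarith [min_le_left (ε / 2) (1 / 2)]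
  -- Half of `η` is reserved for the boundaries and half for the bad points. The class bound `K` is
  -- fixed before the scale `K + 1` at which goodness is required.
  obtain ⟨K, hK⟩ := eventually_isHyperfinite hω hconj hσ S (ε := η / (2 * (S.card + 1)))
    (by positivity)
  obtain ⟨n, hn, hbad⟩ := (hK.and ((hσ.isNull_not_goodAt (insert 1 S ^ (K + 1))).eventually_le
    (δ := η / (2 * (K + 1))) (by positivity))).exists
  obtain ⟨P, hP, hPK, hPB, hPη⟩ := hn.exists_class (η := η) (δ := η / (2 * (K + 1)))
    (B := Finset.univ.filter fun x => ¬ GoodAt (σ n) (insert 1 S ^ (K + 1)) x)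
    (by
      rw [Fintype.card_fin]
      push_cast
      convert hbad) hη1 (by
      have h1 : (S.card : ℝ) * (η / (2 * (S.card + 1))) ≤ η / 2 := by
        rw [mul_div_assoc', div_le_div_iff₀ (by positivity) (by positivity)]
        nlinarith
      have h2 : (K : ℝ) * (η / (2 * (K + 1))) ≤ η / 2 := by
        rw [mul_div_assoc', div_le_div_iff₀ (by positivity) (by positivity)]
        nlinarith
      linarith)
  obtain ⟨F, hF, hFS⟩ := exists_boundary_le_of_good hS (σ := σ n) (K := K) (η := η)
    ⟨P, hP, hPK, fun x hx => by
      by_contra hcon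
      exact Finset.disjoint_left.1 hPB hx (by simpa using hcon), hPη⟩
  refine ⟨F, hF, fun k hk => ?_⟩
  rw [card_smul_symmDiff]
  have h1 := hFS k (Finset.mem_union_left _ hk)
  have h2 : 2 * η * F.card ≤ ε * F.card := by gcongr
  push_cast
  linarith

end SoficRep

theorem theorem2 (ω : Ultrafilter ℕ) (hω : (ω : Filter ℕ) ≤ Filter.cofinite)
    (Γ : Type*) [Group Γ] [Group.FG Γ]
    (hΓ : ∃ φ : Γ →* SoficRep.SoficGroup ω, SoficRep.IsFaithfulEmbedding ω φ) :
    SoficRep.IsAmenable Γ ↔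
      ∀ φ ψ : Γ →* SoficRep.SoficGroup ω,
        SoficRep.IsFaithfulEmbedding ω φ → SoficRep.IsFaithfulEmbedding ω ψ →
          SoficRep.AreConjugate φ ψ := by
  obtain ⟨φ₀, hφ₀⟩ := hΓ
  exact ⟨fun h φ ψ hφ hψ => h.areConjugate hφ hψ,
    fun h => SoficRep.isAmenable_of_forall_areConjugate hω hφ₀ h⟩
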